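/- Let $p$ be a prime and let $F$ be a field of characteristic $p$. For $a_0,\dots,a_{n-1}\in F$ the quasilinear $p$-form $\varphi=\langle a_0,\dots,a_{n-1}\rangle$, $\varphi(v)=\sum_i a_iv_i^p$, of dimension $n$ is called anisotropic if $\varphi(v)=0$ with $v\in F^n$ implies $v=0$, and $X_\varphi$ denotes the quasilinear $p$-hypersurface $\operatorname{Proj}\bigl(F[x_0,\dots,x_{n-1}]/(\sum_i a_ix_i^p)\bigr)$ over $F$; it is integral if $\varphi$ is anisotropic and $n\ge 2$. In that case $\mathfrak{i}_1(X_\varphi)$ denotes the dimension, over the function field $F(X_\varphi)$, of the subspace of all $v\in F(X_\varphi)^n$ with $\varphi(v)=0$. Let $\psi$ and $\varphi$ be anisotropic quasilinear $p$-forms over $F$ of dimension at least $2$, let $X=X_\psi$ and $Y=X_\varphi$, let $f\colon X\dashrightarrow Y$ be a rational map over $F$, and let $Z\subset Y$ be the closure of the image of $f$, with its reduced scheme structure. Then: 1. There exists a rational map $Z\dashrightarrow X$ over $F$. 2. If $\mathfrak{i}_1(X)=1$, then $X$ and $Z$ are birational via $f$: there is an $F$-isomorphism from a dense open subscheme of $X$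 onto a dense open subscheme of $Z$ whose composition with the inclusion $Z\hookrightarrow Y$ represents $f$. -/

import Mathlib

open AlgebraicGeometry CategoryTheory

universe u

/-! ### The grading on the quotient of a graded algebra by a homogeneous ideal -/

section QuotientGrading

variable {R A : Type*} [CommRing R] [CommRing A] [Algebra R A]

/-- The grading induced on `A ⧸ I` by a grading `𝒜` of `A`: its degree `k` part is the image of
`𝒜 k`. -/
def quotientGrading (𝒜 : ℕ → Submodule R A) (I : Ideal A) (k : ℕ) : Submodule R (A ⧸ I) :=
  (𝒜 k).map (Ideal.Quotient.mkₐ R I).toLinearMap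

variable (𝒜 : ℕ → Submodule R A) [GradedAlgebra 𝒜] (I : Ideal A)

theorem quotientGrading_gradedMonoid : SetLike.GradedMonoid (quotientGrading 𝒜 I) where
  one_mem := ⟨1, SetLike.GradedOne.one_mem, map_one (Ideal.Quotient.mkₐ R I)⟩
  mul_mem := by
    rintro i j _ _ ⟨x, hx, rfl⟩ ⟨y, hy, rfl⟩
    exact ⟨x * y, SetLike.GradedMul.mul_mem hx hy, map_mul (Ideal.Quotient.mkₐ R I) x y⟩

/-- The quotient map in degree `k`. -/
def quotientGradingMk (k : ℕ) : 𝒜 k →ₗ[R] quotientGrading 𝒜 I k :=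
  (Ideal.Quotient.mkₐ R I).toLinearMap.restrict fun x hx => ⟨x, hx, rfl⟩

/-- The decomposition of an element of `A` into components, followed by the quotient map in each
degree. -/
noncomputable def quotientGradingPre : A →ₗ[R] DirectSum ℕ fun k => quotientGrading 𝒜 I k :=
  (DirectSum.lmap (quotientGradingMk 𝒜 I)).comp (DirectSum.decomposeLinearEquiv 𝒜).toLinearMap

theorem quotientGradingPre_of_mem {k : ℕ} {x : A} (hx : x ∈ 𝒜 k) :
    quotientGradingPre 𝒜 I x = DirectSum.of (fun k => quotientGrading 𝒜 I k) k
      ⟨Ideal.Quotient.mk I x, x, hx, rfl⟩ := by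
  have h : DirectSum.decompose 𝒜 x = DirectSum.of (fun k => 𝒜 k) k ⟨x, hx⟩ :=
    DirectSum.decompose_of_mem 𝒜 hx
  change DirectSum.lmap (quotientGradingMk 𝒜 I) (DirectSum.decompose 𝒜 x) = _
  rw [h]
  exact DirectSum.lmap_lof (R := R) (quotientGradingMk 𝒜 I) k ⟨x, hx⟩

variable {I} in
theorem quotientGradingPre_eq_zero (hI : I.IsHomogeneous 𝒜) {x : A} (hx : x ∈ I) :
    quotientGradingPre 𝒜 I x = 0 := by
  refine DFinsupp.ext fun k => Subtype.ext ?_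
  change Ideal.Quotient.mk I (DirectSum.decompose 𝒜 x k : A) = 0
  exact Ideal.Quotient.eq_zero_iff_mem.2 (hI k hx)

variable {I} in
/-- The decomposition of an element of `A ⧸ I` into components. -/
noncomputable def quotientGradingDecompose (hI : I.IsHomogeneous 𝒜) :
    (A ⧸ I) →ₗ[R] DirectSum ℕ fun k => quotientGrading 𝒜 I k :=
  letI g : (A ⧸ I) →+ DirectSum ℕ fun k => quotientGrading 𝒜 I k :=
    QuotientAddGroup.lift I.toAddSubgroup (quotientGradingPre 𝒜 I).toAddMonoidHom
      fun _ hx => quotientGradingPre_eq_zero 𝒜 hI hx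
  { g with
    map_smul' := by
      intro r y
      obtain ⟨x, rfl⟩ := Ideal.Quotient.mk_surjective y
      exact (quotientGradingPre 𝒜 I).map_smul r x }

variable {I} in
/-- The quotient of a graded algebra by a homogeneous ideal is a graded algebra. -/
noncomputable abbrev quotientGradedAlgebra (hI : I.IsHomogeneous 𝒜) :
    GradedAlgebra (quotientGrading 𝒜 I) :=
  { quotientGrading_gradedMonoid 𝒜 I,
    DirectSum.Decomposition.ofLinearMap (quotientGrading 𝒜 I)
      (quotientGradingDecompose 𝒜 hI)
      (by
        refine LinearMap.ext fun y => ?_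
        obtain ⟨x, rfl⟩ := Ideal.Quotient.mk_surjective y
        change DirectSum.coeLinearMap (quotientGrading 𝒜 I) (quotientGradingPre 𝒜 I x) =
          Ideal.Quotient.mk I x
        induction x using DirectSum.Decomposition.inductionOn 𝒜 with
        | zero => simp
        | homogeneous x =>
          rw [quotientGradingPre_of_mem 𝒜 I x.2]
          exact DirectSum.coeLinearMap_of _ _ _
        | add x y hx hy => rw [map_add, map_add, hx, hy, map_add])
      (by
        refine DirectSum.linearMap_ext R fun k => LinearMap.ext fun y => ?_
        obtain ⟨_, x, hx, rfl⟩ := y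
        simp only [LinearMap.comp_apply, DirectSum.coeLinearMap_lof, LinearMap.id_apply]
        exact quotientGradingPre_of_mem 𝒜 I hx) with }

end QuotientGrading

/-! ### Quasilinear `p`-forms and quasilinear `p`-hypersurfaces -/

section Forms

variable (p : ℕ) {F : Type u} [Field F] {n : ℕ}

/-- The polynomial `a₀x₀ᵖ + ... + aₙ₋₁xₙ₋₁ᵖ`. -/
noncomputable def diagonalPolynomial (a : Fin n → F) : MvPolynomial (Fin n) F :=
  ∑ i, MvPolynomial.C (a i) * MvPolynomial.X i ^ p

/-- The quasilinear `p`-form `⟨a₀, ..., aₙ₋₁⟩` on `Fⁿ` is anisotropic: it has no nonzero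
isotropic vector. -/
def IsAnisotropic (a : Fin n → F) : Prop :=
  ∀ v : Fin n → F, ∑ i, a i * v i ^ p = 0 → v = 0

/-- The subspace of isotropic vectors, in `Lⁿ`, of the quasilinear `p`-form `⟨b₀, ..., bₙ₋₁⟩` over
a field `L` of characteristic `p`. -/
def isotropicSubspace [Fact p.Prime] {L : Type*} [Field L] [CharP L p] (b : Fin n → L) :
    Submodule L (Fin n → L) where
  carrier := {v | ∑ i, b i * v i ^ p = 0}
  zero_mem' := by simp [(Fact.out : p.Prime).ne_zero]
  add_mem' := by
    intro v w hv hw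
    simp only [Set.mem_ofPred_eq, Pi.add_apply, add_pow_char, mul_add,
      Finset.sum_add_distrib] at hv hw ⊢
    rw [hv, hw, add_zero]
  smul_mem' := by
    intro c v hv
    simp only [Set.mem_ofPred_eq, Pi.smul_apply, smul_eq_mul, mul_pow, mul_left_comm _ (c ^ p),
      ← Finset.mul_sum] at hv ⊢
    rw [hv, mul_zero]

/-- The defect index of a quasilinear `p`-form. -/
noncomputable def defectIndex [Fact p.Prime] {L : Type*} [Field L] [CharP L p]
    (b : Fin n → L) : ℕ :=
  Module.finrank L (isotropicSubspace p b)

/-- The homogeneous coordinate ring `F[x₀, ..., xₙ₋₁] / (a₀x₀ᵖ + ... + aₙ₋₁xₙ₋₁ᵖ)`. -/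
abbrev CoordinateRing (a : Fin n → F) : Type u :=
  MvPolynomial (Fin n) F ⧸ Ideal.span {diagonalPolynomial p a}

/-- The grading of the homogeneous coordinate ring by degree. -/
noncomputable def coordinateGrading (a : Fin n → F) : ℕ → Submodule F (CoordinateRing p a) :=
  quotientGrading (MvPolynomial.homogeneousSubmodule (Fin n) F) _

theorem diagonalPolynomial_isHomogeneous (a : Fin n → F) :
    (diagonalPolynomial p a).IsHomogeneous p := by
  refine MvPolynomial.IsHomogeneous.sum _ _ _ fun i _ => ?_
  simpa using (MvPolynomial.isHomogeneous_C (Fin n) (a i)).mul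
    ((MvPolynomial.isHomogeneous_X F i).pow p)

noncomputable instance (a : Fin n → F) : GradedAlgebra (coordinateGrading p a) :=
  letI : GradedAlgebra (MvPolynomial.homogeneousSubmodule (Fin n) F) := MvPolynomial.gradedAlgebra
  quotientGradedAlgebra _ <| Ideal.homogeneous_span _ _ fun x hx => by
    rw [Set.mem_singleton_iff.1 hx]
    exact ⟨p, diagonalPolynomial_isHomogeneous p a⟩

/-- The quasilinear `p`-hypersurface `{a₀x₀ᵖ + ... + aₙ₋₁xₙ₋₁ᵖ = 0}` in `ℙⁿ⁻¹` over `F`, of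
dimension `n - 2`. -/
noncomputable def Hypersurface (a : Fin n → F) : Scheme.{u} :=
  Proj (coordinateGrading p a)

/-- The structure morphism of the hypersurface. -/
noncomputable instance (a : Fin n → F) : (Hypersurface p a).Over (Spec (.of F)) where
  hom := Proj.toSpecZero (coordinateGrading p a) ≫
    Spec.map (CommRingCat.ofHom (algebraMap F (coordinateGrading p a 0)))

end Forms

/-! ### The function field as an extension of the base field, and the first defect index -/

/-- The inclusion `F → F(X)` of the base field in the function field of an integral `F`-scheme. -/
noncomputable def baseToFunctionField (F : Type u) [Field F] (X : Scheme.{u}) [IsIntegral X]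
    [X.Over (Spec (.of F))] : F →+* X.functionField :=
  (X.presheaf.germ ⊤ (genericPoint X) trivial).hom.comp
    ((X ↘ Spec (.of F)).appTop.hom.comp (Scheme.ΓSpecIso (.of F)).inv.hom)

open Classical in
/-- The integer `𝔦₁(X)` of the hypersurface `X` of the form `φ = ⟨a₀, ..., aₙ₋₁⟩`, i.e. the defect
index of `φ` over the function field `F(X)`. The hypersurface is integral if `φ` is anisotropic of
dimension at least `2`; the value is set to `0` if it is not integral. -/
noncomputable def firstDefectIndex (p : ℕ) [Fact p.Prime] {F : Type u} [Field F] [CharP F p]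
    {n : ℕ} (a : Fin n → F) : ℕ :=
  if h : IsIntegral (Hypersurface p a) then
    letI := h
    let σ := baseToFunctionField F (Hypersurface p a)
    haveI : CharP (Hypersurface p a).functionField p := charP_of_injective_ringHom σ.injective p
    defectIndex p fun i => σ (a i)
  else 0

/-! ### The closure of the image of a rational map -/

section Image

variable {X Y : Scheme.{u}}

/-- The closure in `Y` of the image of (the domain of definition of) a rational map `X ⤏ Y`. -/
def closureOfImage (f : X ⤏ Y) : TopologicalSpace.Closeds Y :=
  .closure (⋃ (g : X.PartialMap Y) (_ : g.toRationalMap = f), Set.range g.hom)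

/-- The closure of the image of a rational map `X ⤏ Y` with its reduced closed subscheme
structure. -/
noncomputable def imageScheme (f : X ⤏ Y) : Scheme.{u} :=
  (Scheme.IdealSheafData.vanishingIdeal (closureOfImage f)).subscheme

/-- The closed immersion of the closure of the image. -/
noncomputable def imageSchemeι (f : X ⤏ Y) : imageScheme f ⟶ Y :=
  (Scheme.IdealSheafData.vanishingIdeal (closureOfImage f)).subschemeι

noncomputable instance (f : X ⤏ Y) (S : Scheme.{u}) [Y.Over S] : (imageScheme f).Over S where
  hom := imageSchemeι f ≫ Y ↘ S

end Image

/-! Let `C` be the homogeneous coordinate ring of `X`, let `M` be its fraction field, which is purely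
transcendental over `F(X)`, and let `K = F^(1/p)`. Both assertions come from one algebraic fact
(`exists_isotropic_of_isotropic`): if an extension `L` of `F` embeds in `M` and some anisotropic
form `φ` over `F` becomes isotropic over `L`, then `ψ` becomes isotropic over `L`.

To see this, let `αᵢ ∈ K` be the `p`-th roots of the coefficients of `ψ`. Then `K ⊗ C` is `K[x] /
(ℓᵖ)` for the linear form `ℓ = ∑ αᵢ xᵢ`, so every nonzero element of the local ring `K ⊗ M` is a
unit times a power of `ℓ`, and `ℓ` has nilpotency index exactly `p`. An isotropic vector of `φ`
over `L` gives a nonzero nilpotent element of `K ⊗ L`. Let `y ∈ K ⊗ L` be a nonzero nilpotent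
element whose order of vanishing `k` along `ℓ` is smallest. If `k > 1`, then `p = kq + r` with `0
< r < k` because `p` is prime. The coordinates of `ℓʳ` in a `K ⊗ L`-basis of `K ⊗ M` are killed
by `y^q`, hence have order at least `r`, hence order greater than `r` by the choice of `k`; so
`ℓʳ⁺¹` divides `ℓʳ`, which is absurd. Hence `k = 1` and `y` generates the nilradical of `K ⊗ M`.
Any coordinate of `ℓ = ∑ αᵢ ⊗ xᵢ` is a multiple of `y`, hence nilpotent, and a nonzero one has
the form `∑ αᵢ ⊗ wᵢ` with `w` an isotropic vector of `ψ` over `L`. The field `K` is realized as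
`F` itself, viewed as an `F`-algebra by Frobenius.

The geometric side translates points into isotropic vectors: for a field `L` over `F`, the
`L`-points of a hypersurface over `F` are the isotropic vectors over `L` up to scaling
(`exists_hypersurfacePoint_eq`, `hypersurfacePoint_eq_of_smul`). For the first assertion the fact
is applied to `L = F(Z)`, which embeds in `F(X) ⊆ M` since `X` dominates `Z`; the isotropic
vector obtained is an `F(Z)`-point of `X`, which spreads out to a rational map `g : Z ⤏ X`. If
`𝔦₁(X) = 1`, then `X` has only one `F(X)`-point over `F`, so `g ∘ f` is the identity
(`rationalMap_eq_id_of_firstDefectIndex_eq_one`). A dominant map with a rational left inverse is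
an open immersion on a dense open subscheme (`exists_isOpenImmersion_of_comp_eq_id`), because
over that subscheme it is a section of a separated morphism, hence a closed immersion, and its
image is dense in a reduced scheme. -/

/-! ### Powers of a generator of the nilradical -/

open TensorProduct

section TruncatedValuation

variable {B : Type*} [CommRing B] {p : ℕ} {ℓ : B}

/-- If every element not divisible by the nilpotent element `ℓ` is a unit, then every nonzero
element is a unit times a power of `ℓ`. -/
theorem exists_isUnit_mul_pow (hunit : ∀ b : B, ¬ ℓ ∣ b → IsUnit b) (hp : ℓ ^ p = 0) {b : B}
    (hb : b ≠ 0) : ∃ k < p, ∃ u : Bˣ, b = u * ℓ ^ k := by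
  classical
  have hex : ∃ k, ¬ ℓ ^ (k + 1) ∣ b := by
    refine ⟨p, fun ⟨c, hc⟩ => hb ?_⟩
    rw [hc, pow_succ, hp]; ring
  obtain ⟨k, hk, hmin⟩ : ∃ k, ¬ ℓ ^ (k + 1) ∣ b ∧ ∀ j < k, ℓ ^ (j + 1) ∣ b :=
    ⟨Nat.find hex, Nat.find_spec hex, fun j hj => not_not.1 (Nat.find_min hex hj)⟩
  have hdvd : ℓ ^ k ∣ b := by
    rcases k with _ | k
    · simp
    · exact hmin k (Nat.lt_succ_self k)
  obtain ⟨c, rfl⟩ := hdvd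
  have hc : IsUnit c := hunit c fun ⟨e, he⟩ => hk ⟨e, by rw [he]; ring⟩
  refine ⟨k, ?_, hc.unit, by rw [IsUnit.unit_spec, mul_comm]⟩
  by_contra h
  exact hb (by rw [pow_eq_zero_of_le (not_lt.1 h) hp, zero_mul])

theorem pow_not_dvd_of_lt (hp1 : ℓ ^ (p - 1) ≠ 0) (hp : ℓ ^ p = 0) {j k : ℕ} (hjk : j < k)
    (hj : j < p) : ¬ ℓ ^ k ∣ ℓ ^ j := by
  rintro ⟨c, hc⟩
  refine hp1 ?_
  have h1 : p - 1 = (p - 1 - j) + j := by omega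
  rw [h1, pow_add, hc, ← mul_assoc, ← pow_add, pow_eq_zero_of_le (by omega) hp, zero_mul]

end TruncatedValuation

/-! ### `p`-th powers in tensor products with a field of `p`-th roots -/

section Frobenius

variable (p : ℕ) [Fact p.Prime] (F K M : Type*) [Field F] [Field K] [Algebra F K]
  [CommRing M] [Algebra F M] [CharP F p]

/-- If `K` consists of `p`-th roots of elements of `F`, then `p`-th powers in `K ⊗ M` come from
`M`. -/
theorem exists_pow_eq_tmul (hK : ∀ k : K, ∃ c : F, algebraMap F K c = k ^ p) (b : K ⊗[F] M) :
    ∃ m : M, b ^ p = 1 ⊗ₜ m := by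
  cases subsingleton_or_nontrivial (K ⊗[F] M) with
  | inl h => exact ⟨0, Subsingleton.elim _ _⟩
  | inr h =>
    have : CharP (K ⊗[F] M) p := charP_of_injective_algebraMap (algebraMap F _).injective p
    induction b with
    | zero => exact ⟨0, by simp [(Fact.out : p.Prime).ne_zero]⟩
    | tmul k m =>
      obtain ⟨c, hc⟩ := hK k
      refine ⟨c • m ^ p, ?_⟩
      rw [Algebra.TensorProduct.tmul_pow, ← hc, Algebra.algebraMap_eq_smul_one,
        TensorProduct.smul_tmul]
    | add x y hx hy =>
      obtain ⟨m, hm⟩ := hx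
      obtain ⟨n, hn⟩ := hy
      exact ⟨m + n, by rw [add_pow_char, hm, hn, tmul_add]⟩

/-- For constants `α i` with `α i ^ p = a i ∈ F`, the tensor `∑ α i ⊗ v i` is a `p`-th root of
the value at `v` of the quasilinear `p`-form with coefficients `a i`. -/
theorem sum_tmul_pow {ι : Type*} [Fintype ι] {α : ι → K} {a : ι → F}
    (hα : ∀ i, α i ^ p = algebraMap F K (a i)) (v : ι → M) :
    (∑ i, α i ⊗ₜ[F] v i) ^ p = 1 ⊗ₜ ∑ i, algebraMap F M (a i) * v i ^ p := by
  cases subsingleton_or_nontrivial (K ⊗[F] M) with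
  | inl h => exact Subsingleton.elim _ _
  | inr h =>
    have : CharP (K ⊗[F] M) p := charP_of_injective_algebraMap (algebraMap F _).injective p
    rw [sum_pow_char, tmul_sum]
    refine Finset.sum_congr rfl fun i _ => ?_
    rw [Algebra.TensorProduct.tmul_pow, hα, Algebra.algebraMap_eq_smul_one,
      TensorProduct.smul_tmul, Algebra.smul_def]

end Frobenius

/-! ### Linear forms on `K ⊗ M` over `K ⊗ L` -/

section Coordinates

variable {F L M : Type*} (K : Type*) [Field F] [Field K] [Field L] [Field M] [Algebra F K]
  [Algebra F L] [Algebra F M] [Algebra L M] [IsScalarTower F L M]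

/-- The inclusion `K ⊗ L → K ⊗ M` induced by a field extension `M / L`. -/
noncomputable def tensorInclusion (F L M : Type*) (K : Type*) [Field F] [Field K] [Field L]
    [Field M] [Algebra F K]
    [Algebra F L] [Algebra F M] [Algebra L M] [IsScalarTower F L M] :
    K ⊗[F] L →ₐ[K] K ⊗[F] M :=
  Algebra.TensorProduct.map (AlgHom.id K K) (IsScalarTower.toAlgHom F L M)

/-- The `K ⊗ L`-linear form `K ⊗ M → K ⊗ L` induced by an `L`-linear form on `M`. -/
noncomputable def tensorForm (θ : M →ₗ[L] L) : K ⊗[F] M →ₗ[F] K ⊗[F] L :=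
  (θ.restrictScalars F).lTensor K

@[simp]
theorem tensorInclusion_tmul (k : K) (x : L) :
    tensorInclusion F L M K (k ⊗ₜ x) = k ⊗ₜ algebraMap L M x := rfl

@[simp]
theorem tensorForm_tmul (θ : M →ₗ[L] L) (k : K) (x : M) :
    tensorForm (F := F) K θ (k ⊗ₜ x) = k ⊗ₜ θ x := rfl

/-- `tensorForm K θ` is linear over `K ⊗ L`. -/
theorem tensorForm_mul (θ : M →ₗ[L] L) (y : K ⊗[F] L) (z : K ⊗[F] M) :
    tensorForm K θ (tensorInclusion F L M K y * z) = y * tensorForm K θ z := by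
  induction y with
  | zero => simp
  | add y y' h h' => rw [map_add, add_mul, map_add, h, h', add_mul]
  | tmul k x =>
    induction z with
    | zero => simp
    | add z z' h h' => rw [mul_add, map_add, h, h', map_add, mul_add]
    | tmul k' x' =>
      simp [Algebra.TensorProduct.tmul_mul_tmul, ← Algebra.smul_def]

theorem tensorInclusion_injective : Function.Injective (tensorInclusion F L M K) := by
  exact Module.Flat.lTensor_preserves_injective_linearMap (M := K)
    ((IsScalarTower.toAlgHom F L M).toLinearMap) (algebraMap L M).injective

/-- Expansion of an element of `K ⊗ M` in the `K ⊗ L`-basis coming from an `L`-basis of `M`. -/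
theorem exists_sum_tensorForm {σ : Type*} (m : Module.Basis σ L M) (z : K ⊗[F] M) :
    ∃ s : Finset σ, z = ∑ i ∈ s, tensorInclusion F L M K (tensorForm K (m.coord i) z) *
      (1 ⊗ₜ m i) := by
  classical
  suffices h : ∃ s : Finset σ, ∀ t, s ⊆ t →
      z = ∑ i ∈ t, tensorInclusion F L M K (tensorForm K (m.coord i) z) * (1 ⊗ₜ m i) by
    obtain ⟨s, hs⟩ := h
    exact ⟨s, hs s subset_rfl⟩
  induction z with
  | zero => exact ⟨∅, by simp⟩
  | add y z hy hz =>
    obtain ⟨s, hs⟩ := hy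
    obtain ⟨s', hs'⟩ := hz
    refine ⟨s ∪ s', fun t ht => ?_⟩
    simp only [map_add, add_mul, Finset.sum_add_distrib]
    rw [← hs t (Finset.union_subset_left ht), ← hs' t (Finset.union_subset_right ht)]
  | tmul k x =>
    refine ⟨(m.repr x).support, fun t ht => ?_⟩
    simp only [tensorForm_tmul, tensorInclusion_tmul, Algebra.TensorProduct.tmul_mul_tmul, mul_one,
      ← tmul_sum, ← Algebra.smul_def, Module.Basis.coord_apply]
    congr 1
    conv_lhs => rw [← m.linearCombination_repr x]
    exact Finsupp.sum_of_support_subset _ ht _ (by simp)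

end Coordinates

/-! ### Descent of a generator of the nilradical -/

section Descent

variable (p : ℕ) [Fact p.Prime] {F K L M : Type*} [Field F] [Field K] [Field L] [Field M]
  [Algebra F K] [Algebra F L] [Algebra F M] [Algebra L M] [IsScalarTower F L M]

/-- If the nilradical of `K ⊗ M` is generated by an element `ℓ` whose nilpotency index is the prime
`p`, then it is generated by an element of `K ⊗ L` as soon as `K ⊗ L` is not reduced. -/
theorem exists_tensorInclusion_eq_unit_mul
    (hunit : ∀ b : K ⊗[F] M, b ^ p = 0 ∨ IsUnit b)
    {ℓ : K ⊗[F] M} (hℓ : ∀ b : K ⊗[F] M, b ^ p = 0 → ℓ ∣ b) (hp : ℓ ^ p = 0)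
    (hp1 : ℓ ^ (p - 1) ≠ 0) {μ : K ⊗[F] L} (hμ : μ ≠ 0) (hμp : μ ^ p = 0) :
    ∃ (y : K ⊗[F] L) (u : (K ⊗[F] M)ˣ), y ^ p = 0 ∧ tensorInclusion F L M K y = u * ℓ := by
  classical
  have hpp : p.Prime := Fact.out
  have hinj := tensorInclusion_injective (F := F) (L := L) (M := M) K
  have hu : ∀ b : K ⊗[F] M, ¬ ℓ ∣ b → IsUnit b := fun b hb =>
    (hunit b).resolve_left fun h => hb (hℓ b h)
  have hne : ∀ y : K ⊗[F] L, y ≠ 0 → tensorInclusion F L M K y ≠ 0 := fun y hy h =>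
    hy (hinj (by rw [h, map_zero]))
  -- The valuations attained by the nonzero nilpotent elements of `K ⊗ L`.
  let P : ℕ → Prop := fun k => 0 < k ∧ k < p ∧ ∃ (y : K ⊗[F] L) (u : (K ⊗[F] M)ˣ),
    tensorInclusion F L M K y = u * ℓ ^ k
  have hP : ∃ k, P k := by
    obtain ⟨k, hk, u, hku⟩ := exists_isUnit_mul_pow hu hp (hne μ hμ)
    refine ⟨k, Nat.pos_of_ne_zero ?_, hk, μ, u, hku⟩
    rintro rfl
    have h : tensorInclusion F L M K (μ ^ p) = (u : K ⊗[F] M) ^ p := by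
      rw [map_pow, hku, pow_zero, mul_one]
    rw [hμp, map_zero] at h
    have h1 : IsUnit (0 : K ⊗[F] M) := h ▸ u.isUnit.pow p
    exact hne μ hμ (eq_zero_of_zero_eq_one (isUnit_zero_iff.1 h1) _)
  obtain ⟨hk0, hkp, y, u, hy⟩ := Nat.find_spec hP
  have hmin := fun j (hj : j < Nat.find hP) => Nat.find_min hP hj
  generalize Nat.find hP = k at *
  obtain rfl | hk1 : k = 1 ∨ 1 < k := by omega
  · refine ⟨y, u, hinj ?_, by simpa using hy⟩
    rw [map_pow, hy, mul_pow, ← pow_mul, one_mul, hp, mul_zero, map_zero]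
  exfalso
  -- Since `1 < k < p` and `p` is prime, `p = k * q + r` with `0 < r < k`.
  have hr0 : 0 < p % k := Nat.pos_of_ne_zero fun h =>
    (Nat.prime_def.1 hpp).2 k (Nat.dvd_of_mod_eq_zero h) |>.elim (by omega) (by omega)
  have hrk : p % k < k := Nat.mod_lt _ hk0
  have hdiv := Nat.div_add_mod p k
  obtain ⟨s, hs⟩ := exists_sum_tensorForm K (Module.Basis.ofVectorSpace L M) (ℓ ^ (p % k))
  refine pow_not_dvd_of_lt hp1 hp (Nat.lt_succ_self (p % k)) (hrk.trans hkp) ?_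
  refine Dvd.dvd.trans (Finset.dvd_sum fun i _ => Dvd.dvd.mul_right ?_ _) hs.symm.dvd
  set θ := (Module.Basis.ofVectorSpace L M).coord i
  set c := tensorForm K θ (ℓ ^ (p % k))
  by_cases hc : c = 0
  · rw [hc, map_zero]; exact dvd_zero _
  -- The coefficient `c` annihilates `y ^ q`, because `ℓ ^ r` does.
  have hann : y ^ (p / k) * c = 0 := by
    rw [← tensorForm_mul, map_pow, hy, mul_pow, ← pow_mul, mul_assoc, ← pow_add, hdiv, hp,
      mul_zero, map_zero]
  obtain ⟨j, hj, w, hw⟩ := exists_isUnit_mul_pow hu hp (hne c hc)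
  have hjr : p % k ≤ j := by
    by_contra hlt
    have h := congrArg (tensorInclusion F L M K) hann
    rw [map_mul, map_pow, hy, hw, map_zero, mul_pow, ← pow_mul,
      show (u : K ⊗[F] M) ^ (p / k) * ℓ ^ (k * (p / k)) * (w * ℓ ^ j) =
        ((u ^ (p / k) * w : (K ⊗[F] M)ˣ) : K ⊗[F] M) * ℓ ^ (k * (p / k) + j) by
        push_cast; rw [pow_add]; ring, Units.mul_right_eq_zero] at h
    exact hp1 (pow_eq_zero_of_le (by omega) h)
  rw [hw]
  refine Dvd.dvd.mul_left (pow_dvd_pow _ ?_) _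
  refine Nat.succ_le_of_lt (lt_of_le_of_ne hjr fun h => ?_)
  exact hmin j (h ▸ hrk) ⟨h ▸ hr0, hj, c, w, hw⟩

/-- **Descent of isotropy.** In the situation of `exists_tensorInclusion_eq_unit_mul`, if the
generator of the nilradical of `K ⊗ M` has the form `∑ α i ⊗ x i` with `α i ^ p = a i ∈ F`, then the
quasilinear `p`-form with coefficients `a i` is isotropic over `L`. -/
theorem exists_isotropic_of_nilpotent [CharP F p]
    (hunit : ∀ b : K ⊗[F] M, b ^ p = 0 ∨ IsUnit b) {ι : Type*} [Fintype ι] {a : ι → F} {α : ι → K}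
    (hα : ∀ i, α i ^ p = algebraMap F K (a i)) (x : ι → M)
    (hℓ : ∀ b : K ⊗[F] M, b ^ p = 0 → (∑ i, α i ⊗ₜ[F] x i) ∣ b)
    (hp : (∑ i, α i ⊗ₜ[F] x i) ^ p = 0) (hp1 : (∑ i, α i ⊗ₜ[F] x i) ^ (p - 1) ≠ 0)
    {μ : K ⊗[F] L} (hμ : μ ≠ 0) (hμp : μ ^ p = 0) :
    ∃ w : ι → L, w ≠ 0 ∧ ∑ i, algebraMap F L (a i) * w i ^ p = 0 := by
  obtain ⟨y, u, hy, hyu⟩ := exists_tensorInclusion_eq_unit_mul p hunit hℓ hp hp1 hμ hμp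
  obtain ⟨s, hs⟩ := exists_sum_tensorForm K (Module.Basis.ofVectorSpace L M)
    (∑ i, α i ⊗ₜ[F] x i)
  have hne : (∑ i, α i ⊗ₜ[F] x i) ≠ 0 := fun h =>
    hp1 (by rw [h, zero_pow]; have := (Fact.out : p.Prime).two_le; omega)
  obtain ⟨i, -, hi⟩ := Finset.exists_ne_zero_of_sum_ne_zero (hs ▸ hne)
  set θ := (Module.Basis.ofVectorSpace L M).coord i
  have hθ : tensorForm (F := F) K θ (∑ i, α i ⊗ₜ[F] x i) = ∑ i, α i ⊗ₜ θ (x i) := by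
    simp
  refine ⟨fun i => θ (x i), fun h => hi ?_, ?_⟩
  · rw [hθ, Finset.sum_eq_zero, map_zero, zero_mul]
    intro j _
    rw [show θ (x j) = 0 from congrFun h j, tmul_zero]
  · have h1 : tensorForm (F := F) K θ (∑ i, α i ⊗ₜ[F] x i) =
        y * tensorForm K θ (u⁻¹ : (K ⊗[F] M)ˣ) := by
      rw [← tensorForm_mul, hyu, mul_right_comm, Units.mul_inv, one_mul]
    have h2 := sum_tmul_pow p F K L hα fun i => θ (x i)
    rw [← hθ, h1, mul_pow, hy, zero_mul] at h2
    exact Algebra.TensorProduct.includeRight_injective (algebraMap F K).injective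
      (h2.symm.trans (tmul_zero _ _).symm)

end Descent

/-! ### Passage to the fraction field -/

section Localization

variable {p : ℕ} {F K C M : Type*} [Field F] [Field K] [CommRing C]
  [Field M] [Algebra F K] [Algebra F C] [Algebra F M] [Algebra C M] [IsScalarTower F C M]
  [IsFractionRing C M]

variable (F K C M) in
/-- The map `K ⊗ C → K ⊗ M` from a domain `C` to its fraction field `M`. -/
noncomputable def tensorToFractionRing : K ⊗[F] C →ₐ[K] K ⊗[F] M :=
  Algebra.TensorProduct.map (AlgHom.id K K) (IsScalarTower.toAlgHom F C M)

theorem tensorToFractionRing_injective : Function.Injective (tensorToFractionRing F K C M) :=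
  Module.Flat.lTensor_preserves_injective_linearMap (M := K)
    ((IsScalarTower.toAlgHom F C M).toLinearMap) (IsFractionRing.injective C M)

theorem exists_mul_eq_tensorToFractionRing [IsDomain C] (b : K ⊗[F] M) :
    ∃ (z : K ⊗[F] C) (c : (K ⊗[F] M)ˣ), c * b = tensorToFractionRing F K C M z := by
  suffices h : ∃ (z : K ⊗[F] C) (c : C), c ≠ 0 ∧
      (1 ⊗ₜ[F] algebraMap C M c) * b = tensorToFractionRing F K C M z by
    obtain ⟨z, c, hc, h⟩ := h
    have hu : IsUnit (1 ⊗ₜ[F] algebraMap C M c : K ⊗[F] M) :=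
      (IsUnit.mk0 (algebraMap C M c) (by simpa using hc)).map
        (Algebra.TensorProduct.includeRight : M →ₐ[F] K ⊗[F] M)
    exact ⟨z, hu.unit, h⟩
  induction b with
  | zero => exact ⟨0, 1, one_ne_zero, by simp⟩
  | tmul k m =>
    obtain ⟨x, y, hy, rfl⟩ := IsFractionRing.div_surjective (A := C) m
    have hy0 : algebraMap C M y ≠ 0 := by simpa using nonZeroDivisors.ne_zero hy
    refine ⟨k ⊗ₜ x, y, nonZeroDivisors.ne_zero hy, ?_⟩
    rw [Algebra.TensorProduct.tmul_mul_tmul, one_mul, mul_div_cancel₀ _ hy0]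
    rfl
  | add b b' h h' =>
    obtain ⟨z, c, hc, h⟩ := h
    obtain ⟨z', c', hc', h'⟩ := h'
    refine ⟨(1 ⊗ₜ c') * z + (1 ⊗ₜ c) * z', c * c', mul_ne_zero hc hc', ?_⟩
    rw [map_add, map_mul (tensorToFractionRing F K C M), map_mul (tensorToFractionRing F K C M),
      ← h, ← h']
    have e : ∀ c : C, tensorToFractionRing F K C M (1 ⊗ₜ c) = 1 ⊗ₜ algebraMap C M c := fun _ => rfl
    have e2 : (1 ⊗ₜ[F] algebraMap C M (c * c') : K ⊗[F] M) =
        (1 ⊗ₜ algebraMap C M c) * (1 ⊗ₜ algebraMap C M c') := by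
      rw [Algebra.TensorProduct.tmul_mul_tmul, map_mul, mul_one]
    rw [e, e, e2]
    ring

theorem dvd_of_pow_eq_zero_of_fractionRing [IsDomain C] {ℓ : K ⊗[F] C}
    (hℓ : ∀ z : K ⊗[F] C, z ^ p = 0 → ℓ ∣ z) (b : K ⊗[F] M) (hb : b ^ p = 0) :
    tensorToFractionRing F K C M ℓ ∣ b := by
  obtain ⟨z, c, h⟩ := exists_mul_eq_tensorToFractionRing (C := C) b
  have hz : z ^ p = 0 := tensorToFractionRing_injective (M := M) (by
    rw [map_pow, ← h, mul_pow, hb, mul_zero, map_zero])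
  have h1 := map_dvd (tensorToFractionRing F K C M) (hℓ z hz)
  rw [← h] at h1
  exact (Units.dvd_mul_left).1 h1

end Localization

/-! ### The homogeneous coordinate ring after adjoining `p`-th roots of the coefficients -/

section LinearForm

variable {K : Type*} [Field K] {n : ℕ}

/-- The linear form `α₀x₀ + ... + αₙ₋₁xₙ₋₁`. -/
noncomputable def linearFormPolynomial (α : Fin n → K) : MvPolynomial (Fin n) K :=
  ∑ i, MvPolynomial.C (α i) * MvPolynomial.X i

theorem prime_linearFormPolynomial {α : Fin n → K} (hα : α ≠ 0) :
    Prime (linearFormPolynomial α) := by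
  classical
  obtain ⟨i, hi⟩ := Function.ne_iff.1 hα
  have hi : α i ≠ 0 := hi
  have h : linearFormPolynomial α = MvPolynomial.sumSMulX (Finsupp.equivFunOnFinite.symm α) := by
    rw [linearFormPolynomial, MvPolynomial.sumSMulX, Finsupp.linearCombination_apply,
      Finsupp.sum_fintype _ _ (by simp)]
    exact Finset.sum_congr rfl fun i _ => by simp [MvPolynomial.smul_eq_C_mul]
  rw [h]
  refine (MvPolynomial.irreducible_sumSMulX _ ⟨i, by simpa using hi⟩ fun r hr => ?_).prime
  exact isUnit_of_dvd_unit (hr i) (by simpa using hi)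

end LinearForm

section Quotient

variable (p : ℕ) [Fact p.Prime] {F : Type u} [Field F] [CharP F p] {n : ℕ} {a : Fin n → F}
  {K : Type*} [Field K] [Algebra F K] {α : Fin n → K}

include p in
/-- Over a field that contains `p`-th roots of its coefficients, the polynomial of a quasilinear
`p`-form is the `p`-th power of a linear form. -/
theorem map_diagonalPolynomial (hα : ∀ i, α i ^ p = algebraMap F K (a i)) :
    MvPolynomial.map (algebraMap F K) (diagonalPolynomial p a) = linearFormPolynomial α ^ p := by
  have : CharP K p := charP_of_injective_algebraMap (algebraMap F K).injective p
  rw [diagonalPolynomial, linearFormPolynomial, sum_pow_char, map_sum]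
  refine Finset.sum_congr rfl fun i _ => ?_
  rw [mul_pow, map_mul, map_pow, MvPolynomial.map_C, MvPolynomial.map_X, ← hα, map_pow]

/-- The coordinate functions of the homogeneous coordinate ring. -/
noncomputable def coordinate (p : ℕ) {F : Type u} [Field F] {n : ℕ} (a : Fin n → F) (i : Fin n) :
    CoordinateRing p a :=
  Ideal.Quotient.mk _ (MvPolynomial.X i)

theorem sum_coordinate_pow (p : ℕ) {F : Type u} [Field F] {n : ℕ} (a : Fin n → F) :
    ∑ i, algebraMap F (CoordinateRing p a) (a i) * coordinate p a i ^ p = 0 := by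
  have h : Ideal.Quotient.mk (Ideal.span {diagonalPolynomial p a}) (diagonalPolynomial p a) = 0 :=
    Ideal.Quotient.eq_zero_iff_mem.2 (Ideal.mem_span_singleton_self _)
  rw [← h]
  unfold diagonalPolynomial
  rw [map_sum]
  refine Finset.sum_congr rfl fun i _ => ?_
  rw [map_mul, map_pow]
  rfl

variable (K a) in
/-- The map `K[x] → K ⊗ C`, where `C` is the homogeneous coordinate ring. -/
noncomputable def polynomialToTensor : MvPolynomial (Fin n) K →ₐ[K] K ⊗[F] CoordinateRing p a :=
  MvPolynomial.aeval fun i => (1 : K) ⊗ₜ[F] coordinate p a i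

omit [Fact p.Prime] [CharP F p] in
theorem polynomialToTensor_surjective : Function.Surjective (polynomialToTensor p a K) := by
  intro z
  induction z with
  | zero => exact ⟨0, map_zero _⟩
  | add z z' h h' =>
    obtain ⟨g, rfl⟩ := h
    obtain ⟨g', rfl⟩ := h'
    exact ⟨g + g', map_add _ _ _⟩
  | tmul k c =>
    obtain ⟨q, rfl⟩ := Ideal.Quotient.mk_surjective c
    suffices h : ∃ g, polynomialToTensor p a K g = (1 : K) ⊗ₜ[F] Ideal.Quotient.mk _ q by
      obtain ⟨g, hg⟩ := h
      exact ⟨k • g, by rw [map_smul, hg, TensorProduct.smul_tmul', smul_eq_mul, mul_one]⟩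
    induction q using MvPolynomial.induction_on with
    | C c =>
      refine ⟨MvPolynomial.C (algebraMap F K c), ?_⟩
      rw [polynomialToTensor, MvPolynomial.aeval_C]
      exact (Algebra.TensorProduct.tmul_one_eq_one_tmul c)
    | add q q' h h' =>
      obtain ⟨g, hg⟩ := h
      obtain ⟨g', hg'⟩ := h'
      exact ⟨g + g', by rw [map_add, map_add, tmul_add, hg, hg']⟩
    | mul_X q i h =>
      obtain ⟨g, hg⟩ := h
      refine ⟨g * MvPolynomial.X i, ?_⟩
      rw [map_mul, map_mul, hg, polynomialToTensor, MvPolynomial.aeval_X,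
        Algebra.TensorProduct.tmul_mul_tmul, one_mul]
      rfl

/-- The map `K ⊗ C → K[x] / (ℓ ^ p)`, where `C` is the homogeneous coordinate ring and `ℓ` the
linear form whose coefficients are the `p`-th roots of those of the quasilinear `p`-form. -/
noncomputable def tensorToQuotient (hα : ∀ i, α i ^ p = algebraMap F K (a i)) :
    K ⊗[F] CoordinateRing p a →ₐ[K]
      MvPolynomial (Fin n) K ⧸ Ideal.span {linearFormPolynomial α ^ p} :=
  Algebra.TensorProduct.lift (Algebra.ofId K _)
    (Ideal.Quotient.liftₐ _
      (MvPolynomial.aeval fun i => Ideal.Quotient.mk _ (MvPolynomial.X i)) <| by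
      intro q hq
      have h : ∀ q : MvPolynomial (Fin n) F,
          MvPolynomial.aeval (fun i => Ideal.Quotient.mk
            (Ideal.span {linearFormPolynomial α ^ p}) (MvPolynomial.X i)) q =
          Ideal.Quotient.mk (Ideal.span {linearFormPolynomial α ^ p})
            (MvPolynomial.map (algebraMap F K) q) := by
        intro q
        induction q using MvPolynomial.induction_on with
        | C c => rw [MvPolynomial.aeval_C, MvPolynomial.map_C]; rfl
        | add q q' h h' => rw [map_add, h, h', map_add, map_add]
        | mul_X q i h => rw [map_mul, h, map_mul, map_mul, MvPolynomial.aeval_X,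
            MvPolynomial.map_X]
      obtain ⟨r, rfl⟩ := Ideal.mem_span_singleton'.1 hq
      rw [h, map_mul, map_diagonalPolynomial p hα, map_mul,
        Ideal.Quotient.eq_zero_iff_mem.2 (Ideal.mem_span_singleton_self _), mul_zero])
    fun _ _ => Commute.all _ _

theorem tensorToQuotient_polynomialToTensor (hα : ∀ i, α i ^ p = algebraMap F K (a i))
    (g : MvPolynomial (Fin n) K) :
    tensorToQuotient p hα (polynomialToTensor p a K g) = Ideal.Quotient.mk _ g := by
  have h : (tensorToQuotient p hα).comp (polynomialToTensor p a K) =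
      Ideal.Quotient.mkₐ K (Ideal.span {linearFormPolynomial α ^ p}) := by
    refine MvPolynomial.algHom_ext fun i => ?_
    rw [AlgHom.comp_apply, polynomialToTensor, MvPolynomial.aeval_X, tensorToQuotient,
      Algebra.TensorProduct.lift_tmul, map_one, one_mul]
    exact MvPolynomial.aeval_X _ _
  exact DFunLike.congr_fun h g

omit [Fact p.Prime] [CharP F p] in
theorem polynomialToTensor_linearFormPolynomial :
    polynomialToTensor p a K (linearFormPolynomial α) = ∑ i, α i ⊗ₜ[F] coordinate p a i := by
  rw [linearFormPolynomial, map_sum]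
  refine Finset.sum_congr rfl fun i _ => ?_
  rw [polynomialToTensor, map_mul, MvPolynomial.aeval_X, MvPolynomial.algHom_C,
    Algebra.TensorProduct.algebraMap_apply, Algebra.TensorProduct.tmul_mul_tmul, mul_one, one_mul]
  rfl

theorem sum_tmul_coordinate_dvd (hα : ∀ i, α i ^ p = algebraMap F K (a i)) (hα0 : α ≠ 0)
    (z : K ⊗[F] CoordinateRing p a) (hz : z ^ p = 0) :
    (∑ i, α i ⊗ₜ[F] coordinate p a i) ∣ z := by
  obtain ⟨g, rfl⟩ := polynomialToTensor_surjective p z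
  rw [← polynomialToTensor_linearFormPolynomial]
  refine map_dvd _ ?_
  have hg : polynomialToTensor p a K (g ^ p) = polynomialToTensor p a K g ^ p :=
    (polynomialToTensor p a K).map_pow _ _
  have h := congrArg (tensorToQuotient p hα) hz
  rw [← hg, tensorToQuotient_polynomialToTensor, map_zero, Ideal.Quotient.eq_zero_iff_mem,
    Ideal.mem_span_singleton] at h
  exact (prime_linearFormPolynomial hα0).dvd_of_dvd_pow
    ((dvd_pow_self _ (Fact.out : p.Prime).ne_zero).trans h)

theorem sum_tmul_coordinate_pow_ne_zero (hα : ∀ i, α i ^ p = algebraMap F K (a i)) (hα0 : α ≠ 0) :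
    (∑ i, α i ⊗ₜ[F] coordinate p a i) ^ (p - 1) ≠ 0 := by
  intro h0
  have h := congrArg (tensorToQuotient p hα) h0
  have hg : polynomialToTensor p a K (linearFormPolynomial α ^ (p - 1)) =
    polynomialToTensor p a K (linearFormPolynomial α) ^ (p - 1) :=
    (polynomialToTensor p a K).map_pow _ _
  rw [← polynomialToTensor_linearFormPolynomial, ← hg, tensorToQuotient_polynomialToTensor,
    map_zero, Ideal.Quotient.eq_zero_iff_mem, Ideal.mem_span_singleton] at h
  have hl := prime_linearFormPolynomial hα0
  have := (pow_dvd_pow_iff hl.ne_zero hl.not_isUnit).1 h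
  have := (Fact.out : p.Prime).pos
  omega

end Quotient

/-! ### Irreducibility of the polynomial of an anisotropic form -/

section Domain

theorem IsAnisotropic.coeff_ne_zero {F : Type u} [Field F] {p n : ℕ} (hp : p ≠ 0) {a : Fin n → F}
    (ha : IsAnisotropic p a) (i : Fin n) : a i ≠ 0 := by
  intro h
  have h1 := ha (Pi.single i 1) (by
    rw [Finset.sum_eq_single i, h, zero_mul]
    · intro j _ hj
      rw [Pi.single_eq_of_ne hj, zero_pow hp, mul_zero]
    · simp)
  simpa using congrFun h1 i

variable (p : ℕ) [Fact p.Prime] {F : Type u} [Field F] [CharP F p] {d : ℕ} {a : Fin (d + 2) → F}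
  (ha : IsAnisotropic p a)

include ha

/-- Over the field `K` of `p`-th roots the only factors of the polynomial are powers of a linear
form, and on a suitable line the polynomial becomes `a₀xᵖ + a₁`, which is irreducible over `F`. -/
theorem irreducible_diagonalPolynomial_of_root {K : Type*} [Field K] [Algebra F K]
    {α : Fin (d + 2) → K} (hα : ∀ i, α i ^ p = algebraMap F K (a i)) :
    Irreducible (diagonalPolynomial p a) := by
  have hpp : p.Prime := Fact.out
  have ha0 := fun i => ha.coeff_ne_zero hpp.ne_zero i
  have hα0 : ∀ i, α i ≠ 0 := fun i h => ha0 i (by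
    have := hα i
    rwa [h, zero_pow hpp.ne_zero, eq_comm, map_eq_zero] at this)
  have hl : Prime (linearFormPolynomial α) :=
    prime_linearFormPolynomial fun h => hα0 0 (congrFun h 0)
  -- Restriction to the line `x₁ = 1`, `xᵢ = 0` for `i > 1`.
  let s : MvPolynomial (Fin (d + 2)) F →ₐ[F] Polynomial F :=
    MvPolynomial.aeval (Fin.cons Polynomial.X (Fin.cons 1 0))
  let t : MvPolynomial (Fin (d + 2)) K →ₐ[K] Polynomial K :=
    MvPolynomial.aeval (Fin.cons Polynomial.X (Fin.cons 1 0))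
  have hst : ∀ q, t (MvPolynomial.map (algebraMap F K) q) =
      Polynomial.mapRingHom (algebraMap F K) (s q) := by
    intro q
    induction q using MvPolynomial.induction_on with
    | C c => simp [s, t]
    | add q q' h h' => rw [map_add, map_add, map_add, map_add, h, h']
    | mul_X q i h =>
      rw [map_mul, map_mul, map_mul, map_mul, h, MvPolynomial.map_X]
      congr 1
      refine Fin.cases ?_ (fun i => Fin.cases ?_ (fun i => ?_) i) i <;> simp [s, t]
  have hs : s (diagonalPolynomial p a) =
      Polynomial.C (a 0) * (Polynomial.X ^ p - Polynomial.C (-(a 1 / a 0))) := by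
    rw [diagonalPolynomial, map_sum, Fin.sum_univ_succ, Fin.sum_univ_succ]
    simp only [map_mul, map_pow, s, MvPolynomial.aeval_X, MvPolynomial.algHom_C, Fin.cons_zero,
      Fin.cons_succ, Pi.zero_apply, zero_pow hpp.ne_zero, mul_zero, Finset.sum_const_zero]
    rw [mul_sub, ← Polynomial.C_mul, mul_neg, mul_div_cancel₀ _ (ha0 0), Polynomial.C_neg,
      sub_neg_eq_add]
    simp
  have hirr : Irreducible (s (diagonalPolynomial p a)) := by
    rw [hs, irreducible_isUnit_mul (Polynomial.isUnit_C.2 (ha0 0).isUnit)]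
    refine X_pow_sub_C_irreducible_of_prime hpp fun b hb => ?_
    have h := ha (Fin.cons b (Fin.cons 1 0)) (by
      rw [Fin.sum_univ_succ, Fin.sum_univ_succ]
      simp only [Fin.cons_zero, Fin.cons_succ, Pi.zero_apply, zero_pow hpp.ne_zero, mul_zero,
        Finset.sum_const_zero, hb, one_pow]
      rw [mul_neg, mul_div_cancel₀ _ (ha0 0)]
      simp)
    simpa using congrFun h 1
  -- A factor is a power of `ℓ` over `K`, so it is constant once its restriction to the line is.
  have key : ∀ q, MvPolynomial.map (algebraMap F K) q ∣ linearFormPolynomial α ^ p →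
      IsUnit (s q) → IsUnit q := by
    intro q hq hu
    obtain ⟨i, -, hi⟩ := (dvd_prime_pow hl p).1 hq
    have h1 : IsUnit (t (linearFormPolynomial α) ^ i) := by
      rw [← map_pow]
      refine (hi.map t).isUnit ?_
      rw [hst]
      exact hu.map _
    have h2 : t (linearFormPolynomial α) =
        Polynomial.C (α 0) * Polynomial.X + Polynomial.C (α 1) := by
      rw [linearFormPolynomial, map_sum, Fin.sum_univ_succ, Fin.sum_univ_succ]
      simp [t]
    have h3 : i = 0 := by
      by_contra h0
      have := Polynomial.natDegree_eq_zero_of_isUnit (isUnit_of_dvd_unit (dvd_pow_self _ h0) h1)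
      rw [h2, Polynomial.natDegree_linear (hα0 0)] at this
      exact one_ne_zero this
    rw [h3, pow_zero, associated_one_iff_isUnit] at hi
    rw [MvPolynomial.isUnit_iff_totalDegree_of_isReduced] at hi ⊢
    refine ⟨?_, ?_⟩
    · have := hi.1
      rwa [MvPolynomial.coeff_map, isUnit_map_iff] at this
    · rw [← hi.2, MvPolynomial.totalDegree, MvPolynomial.totalDegree,
        MvPolynomial.support_map_of_injective _ (algebraMap F K).injective]
  refine ⟨fun h => hirr.not_isUnit (h.map s), fun P Q hPQ => ?_⟩
  have hmap : MvPolynomial.map (algebraMap F K) P * MvPolynomial.map (algebraMap F K) Q =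
      linearFormPolynomial α ^ p := by
    rw [← map_mul, ← hPQ, map_diagonalPolynomial p hα]
  exact (hirr.isUnit_or_isUnit (by rw [hPQ, map_mul])).imp (key P ⟨_, hmap.symm⟩)
    (key Q ⟨_, by rw [mul_comm, hmap]⟩)

end Domain

/-! ### Descent of isotropy -/

section Anisotropic

theorem sum_tmul_ne_zero_of_linearIndependent {F K V ι : Type*} [Field F] [AddCommGroup K]
    [Module F K] [AddCommGroup V] [Module F V] [Fintype ι] {β : ι → K}
    (hβ : LinearIndependent F β) {v : ι → V} (hv : v ≠ 0) : ∑ j, β j ⊗ₜ[F] v j ≠ 0 := by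
  classical
  obtain ⟨j, hj⟩ := Function.ne_iff.1 hv
  obtain ⟨g, hg⟩ := LinearMap.exists_leftInverse_of_injective (Finsupp.linearCombination F β)
    (LinearMap.ker_eq_bot.2 hβ)
  intro h
  have hgβ : ∀ i, g (β i) = Finsupp.single i 1 := fun i => by
    have := DFunLike.congr_fun hg (Finsupp.single i 1)
    simpa using this
  have h1 := congrArg (TensorProduct.lid F V ∘ ((Finsupp.lapply j).comp g).rTensor V) h
  simp only [Function.comp_apply, map_sum, LinearMap.rTensor_tmul, LinearMap.comp_apply, hgβ,
    Finsupp.lapply_apply, TensorProduct.lid_tmul, map_zero] at h1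
  rw [Finset.sum_eq_single j (fun i _ hi => by rw [Finsupp.single_eq_of_ne hi.symm, zero_smul])
    (by simp), Finsupp.single_eq_same, one_smul] at h1
  exact hj h1

variable (p : ℕ) [Fact p.Prime] {F : Type u} [Field F] [CharP F p]

/-- For an anisotropic form, the `p`-th roots of the coefficients are linearly independent. Here
the extension `F^(1/p)` of `F` is realized by the Frobenius endomorphism of `F`. -/
theorem IsAnisotropic.linearIndependent_frobenius {n : ℕ} {a : Fin n → F}
    (ha : IsAnisotropic p a) :
    letI := (frobenius F p).toAlgebra.toModule
    LinearIndependent F a := by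
  let _ := (frobenius F p).toAlgebra.toModule
  rw [Fintype.linearIndependent_iff]
  intro g hg i
  refine congrFun (ha g ?_) i
  rw [← hg]
  exact Finset.sum_congr rfl fun i _ => mul_comm _ _

theorem irreducible_diagonalPolynomial {d : ℕ} {a : Fin (d + 2) → F} (ha : IsAnisotropic p a) :
    Irreducible (diagonalPolynomial p a) :=
  letI := (frobenius F p).toAlgebra
  irreducible_diagonalPolynomial_of_root p ha (K := F) (α := a) fun _ => rfl

theorem isDomain_coordinateRing {d : ℕ} {a : Fin (d + 2) → F} (ha : IsAnisotropic p a) :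
    IsDomain (CoordinateRing p a) := by
  have h := irreducible_diagonalPolynomial p ha
  have : (Ideal.span {diagonalPolynomial p a}).IsPrime :=
    (Ideal.span_singleton_prime h.ne_zero).2 h.prime
  exact Ideal.Quotient.isDomain _

end Anisotropic

section DescentOfIsotropy

variable (p : ℕ) [Fact p.Prime] {F : Type u} [Field F] [CharP F p] {n m : ℕ}

/-- Descent of isotropy, with the field of `p`-th roots given as an extension `K` of `F`. -/
theorem exists_isotropic_of_root {K L M : Type*} [Field K] [Field L] [Field M]
    [Algebra F K] [Algebra F L] [Algebra F M] [Algebra L M] [IsScalarTower F L M]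
    {a : Fin n → F} [IsDomain (CoordinateRing p a)] [Algebra (CoordinateRing p a) M]
    [IsScalarTower F (CoordinateRing p a) M] [IsFractionRing (CoordinateRing p a) M]
    (hK : ∀ k : K, ∃ c : F, algebraMap F K c = k ^ p) {α : Fin n → K}
    (hα : ∀ i, α i ^ p = algebraMap F K (a i)) (hα0 : α ≠ 0) {b : Fin m → F} {β : Fin m → K}
    (hβ : ∀ i, β i ^ p = algebraMap F K (b i)) (hβi : LinearIndependent F β)
    {v : Fin m → L} (hv : v ≠ 0) (hvb : ∑ i, algebraMap F L (b i) * v i ^ p = 0) :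
    ∃ w : Fin n → L, w ≠ 0 ∧ ∑ i, algebraMap F L (a i) * w i ^ p = 0 := by
  have hunit : ∀ z : K ⊗[F] M, z ^ p = 0 ∨ IsUnit z := by
    intro z
    obtain ⟨y, hy⟩ := exists_pow_eq_tmul p F K M hK z
    by_cases h : y = 0
    · exact Or.inl (by rw [hy, h, tmul_zero])
    · refine Or.inr (isUnit_of_dvd_unit (dvd_pow_self z (Fact.out : p.Prime).ne_zero) ?_)
      rw [hy]
      exact (IsUnit.mk0 y h).map (Algebra.TensorProduct.includeRight : M →ₐ[F] K ⊗[F] M)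
  have hμ := sum_tmul_ne_zero_of_linearIndependent hβi hv
  have hμp : (∑ j, β j ⊗ₜ[F] v j) ^ p = 0 := by
    rw [sum_tmul_pow p F K L hβ, hvb, tmul_zero]
  have hℓ : tensorToFractionRing F K (CoordinateRing p a) M
      (∑ i, α i ⊗ₜ[F] coordinate p a i) =
      ∑ i, α i ⊗ₜ[F] algebraMap (CoordinateRing p a) M (coordinate p a i) := by
    rw [map_sum]; rfl
  refine exists_isotropic_of_nilpotent p hunit hα
    (fun i => algebraMap (CoordinateRing p a) M (coordinate p a i)) ?_ ?_ ?_ hμ hμp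
  · rw [← hℓ]
    exact dvd_of_pow_eq_zero_of_fractionRing (sum_tmul_coordinate_dvd p hα hα0)
  · rw [sum_tmul_pow p F K M hα]
    have h := congrArg (algebraMap (CoordinateRing p a) M) (sum_coordinate_pow p a)
    rw [map_sum, map_zero] at h
    rw [← tmul_zero (M := K) M (1 : K), ← h]
    congr 1
    refine Finset.sum_congr rfl fun i _ => ?_
    rw [map_mul, map_pow, ← IsScalarTower.algebraMap_apply]
  · rw [← hℓ, ← map_pow]
    intro h
    exact sum_tmul_coordinate_pow_ne_zero p hα hα0
      (tensorToFractionRing_injective (M := M) (h.trans (map_zero _).symm))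

/-- **Isotropy descends along the function field of the affine cone.** Let `L` be an extension of
`F` that embeds in the fraction field of the homogeneous coordinate ring of the form with
coefficients `a`. If some anisotropic form over `F` becomes isotropic over `L`, then so does the
form with coefficients `a`. -/
theorem exists_isotropic_of_isotropic {L M : Type*} [Field L] [Field M] [Algebra F L] [Algebra F M]
    [Algebra L M] [IsScalarTower F L M] {d : ℕ} {a : Fin (d + 2) → F} (ha : IsAnisotropic p a)
    [Algebra (CoordinateRing p a) M] [IsScalarTower F (CoordinateRing p a) M]
    [IsFractionRing (CoordinateRing p a) M] {b : Fin m → F} (hb : IsAnisotropic p b)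
    {v : Fin m → L} (hv : v ≠ 0) (hvb : ∑ i, algebraMap F L (b i) * v i ^ p = 0) :
    ∃ w : Fin (d + 2) → L, w ≠ 0 ∧ ∑ i, algebraMap F L (a i) * w i ^ p = 0 := by
  have := isDomain_coordinateRing p ha
  refine @exists_isotropic_of_root p _ F _ _ (d + 2) m F L M _ _ _ (frobenius F p).toAlgebra
    _ _ _ _ a _ _ _ _ (fun k => ⟨k, rfl⟩) a (fun _ => rfl) ?_ b b (fun _ => rfl)
    (hb.linearIndependent_frobenius p) v hv hvb
  exact fun h => ha.coeff_ne_zero (Fact.out : p.Prime).ne_zero 0 (congrFun h 0)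

end DescentOfIsotropy

/-! ### Points of `Proj` with values in a field -/

section ProjPoint

open HomogeneousLocalization

variable {σ : Type*} {A L : Type u} [CommRing A] [CommRing L] [SetLike σ A] [AddSubgroupClass σ A]
  (𝒜 : ℕ → σ) [GradedRing 𝒜] (φ : A →+* L)

/-- The map `(A_t)₀ → L` induced by a ring homomorphism `φ : A → L` such that `φ t` is
invertible. -/
noncomputable def evalAway {t : A} (ht : IsUnit (φ t)) : Away 𝒜 t →+* L :=
  (Localization.awayLift φ t ht).comp (algebraMap (Away 𝒜 t) (Localization.Away t))

variable {φ}

theorem evalAway_mk_mul {t : A} (ht : IsUnit (φ t)) {m : ℕ} (hm : t ∈ 𝒜 m) (n : ℕ) (c : A)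
    (hc : c ∈ 𝒜 (n • m)) : evalAway 𝒜 φ ht (Away.mk 𝒜 hm n c hc) * φ t ^ n = φ c := by
  have hL : ∀ x, Localization.awayLift φ t ht (algebraMap A _ x) = φ x :=
    IsLocalization.Away.lift_eq t ht
  rw [evalAway, RingHom.comp_apply, HomogeneousLocalization.algebraMap_apply, Away.val_mk,
    Localization.mk_eq_mk', ← map_pow, ← hL (t ^ n), ← map_mul,
    IsLocalization.mk'_spec _ c (⟨t ^ n, n, rfl⟩ : Submonoid.powers t), hL]

theorem evalAway_fromZeroRingHom {t : A} (ht : IsUnit (φ t)) (c : 𝒜 0) :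
    evalAway 𝒜 φ ht (fromZeroRingHom 𝒜 _ c) = φ c :=
  IsLocalization.Away.lift_eq t ht (c : A)

theorem evalAway_comp_awayMap {t s : A} (ht : IsUnit (φ t)) (hts : IsUnit (φ (t * s))) {m k : ℕ}
    (hm : t ∈ 𝒜 m) (hk : s ∈ 𝒜 k) :
    (evalAway 𝒜 φ hts).comp (awayMap 𝒜 hk rfl) = evalAway 𝒜 φ ht := by
  ext x
  obtain ⟨n, c, hc, rfl⟩ := Away.mk_surjective 𝒜 hm x
  have h1 := evalAway_mk_mul 𝒜 ht hm n c hc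
  have h2 := evalAway_mk_mul 𝒜 hts (SetLike.mul_mem_graded hm hk) n (c * s ^ n) (by
    rw [smul_add]; exact SetLike.mul_mem_graded hc (SetLike.pow_mem_graded n hk))
  rw [RingHom.comp_apply, awayMap_mk]
  refine (hts.pow n).mul_right_cancel ?_
  rw [h2, map_mul, map_mul, mul_pow, ← mul_assoc, h1, map_pow]

/-- The point of `Proj 𝒜` with values in `L` given by a ring homomorphism `φ : A → L` and a
homogeneous element `t` of positive degree such that `φ t` is invertible. -/
noncomputable def projPoint {t : A} (ht : IsUnit (φ t)) {m : ℕ} (hm : t ∈ 𝒜 m) (h0 : 0 < m) :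
    Spec (.of L) ⟶ Proj 𝒜 :=
  Spec.map (CommRingCat.ofHom (evalAway 𝒜 φ ht)) ≫ Proj.awayι 𝒜 t hm h0

theorem projPoint_mul {t s : A} (ht : IsUnit (φ t)) (hs : IsUnit (φ s)) {m k : ℕ}
    (hm : t ∈ 𝒜 m) (hk : s ∈ 𝒜 k) (h0 : 0 < m) :
    projPoint 𝒜 ht hm h0 = projPoint 𝒜 (t := t * s) (by rw [map_mul]; exact ht.mul hs)
      (SetLike.mul_mem_graded hm hk) (h0.trans_le (m.le_add_right k)) := by
  rw [projPoint, projPoint, ← evalAway_comp_awayMap 𝒜 ht (by rw [map_mul]; exact ht.mul hs) hm hk,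
    CommRingCat.ofHom_comp, Spec.map_comp, Category.assoc, Proj.SpecMap_awayMap_awayι]

/-- The point defined by a ring homomorphism does not depend on the chart. -/
theorem projPoint_eq {t s : A} (ht : IsUnit (φ t)) (hs : IsUnit (φ s)) {m k : ℕ}
    (hm : t ∈ 𝒜 m) (hk : s ∈ 𝒜 k) (h0 : 0 < m) (h0' : 0 < k) :
    projPoint 𝒜 ht hm h0 = projPoint 𝒜 hs hk h0' := by
  rw [projPoint_mul 𝒜 ht hs hm hk h0, projPoint_mul 𝒜 hs ht hk hm h0']
  congr 1 <;> simp only [mul_comm, add_comm]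

theorem projPoint_toSpecZero {t : A} (ht : IsUnit (φ t)) {m : ℕ} (hm : t ∈ 𝒜 m) (h0 : 0 < m) :
    projPoint 𝒜 ht hm h0 ≫ Proj.toSpecZero 𝒜 =
      Spec.map (CommRingCat.ofHom (φ.comp (algebraMap (𝒜 0) A))) := by
  rw [projPoint, Category.assoc, Proj.awayι_toSpecZero, ← Spec.map_comp, ← CommRingCat.ofHom_comp]
  congr 2
  ext c
  exact evalAway_fromZeroRingHom 𝒜 ht c

end ProjPoint

/-! ### Field-valued points of hypersurfaces and their homogeneous coordinates -/

section Homogeneous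

theorem MvPolynomial.IsHomogeneous.eval₂_mul {R S ι : Type*} [CommSemiring R] [CommSemiring S]
    {q : MvPolynomial ι R} {n : ℕ} (hq : q.IsHomogeneous n) (f : R →+* S) (r : S) (x : ι → S) :
    MvPolynomial.eval₂ f (fun i => r * x i) q = r ^ n * MvPolynomial.eval₂ f x q := by
  classical
  rw [MvPolynomial.eval₂_eq, MvPolynomial.eval₂_eq, Finset.mul_sum]
  refine Finset.sum_congr rfl fun m hm => ?_
  have h : ∑ i ∈ m.support, m i = n := by
    have := hq (MvPolynomial.mem_support_iff.1 hm)
    rw [Finsupp.weight_apply, Finsupp.sum,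
      Finset.sum_congr rfl fun i _ => smul_eq_mul (m i) _] at this
    simpa only [Pi.one_apply, mul_one] using this
  simp only [mul_pow, Finset.prod_mul_distrib, Finset.prod_pow_eq_pow_sum, h]
  ring

end Homogeneous

section HypersurfacePoint

open HomogeneousLocalization

variable {p : ℕ} {F : Type u} [Field F] {n : ℕ} {a : Fin n → F}

theorem coordinate_mem (i : Fin n) : coordinate p a i ∈ coordinateGrading p a 1 :=
  ⟨MvPolynomial.X i, MvPolynomial.isHomogeneous_X F i, rfl⟩

section Ring

variable {L : Type*} [CommRing L] (σ : F →+* L)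

/-- The ring homomorphism on the homogeneous coordinate ring given by evaluation at a zero of the
quasilinear `p`-form. -/
noncomputable def evalCoordinateRing {w : Fin n → L} (hw : ∑ i, σ (a i) * w i ^ p = 0) :
    CoordinateRing p a →+* L :=
  Ideal.Quotient.lift _ (MvPolynomial.eval₂Hom σ w) fun q hq => by
    obtain ⟨r, rfl⟩ := Ideal.mem_span_singleton'.1 hq
    have h : MvPolynomial.eval₂Hom σ w (diagonalPolynomial p a) = 0 := by
      rw [← hw]
      unfold diagonalPolynomial
      rw [map_sum]
      refine Finset.sum_congr rfl fun i _ => ?_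
      rw [map_mul, map_pow, MvPolynomial.coe_eval₂Hom, MvPolynomial.eval₂_C, MvPolynomial.eval₂_X]
    rw [map_mul, h, mul_zero]

variable {σ} {w : Fin n → L} (hw : ∑ i, σ (a i) * w i ^ p = 0)

@[simp]
theorem evalCoordinateRing_coordinate (i : Fin n) :
    evalCoordinateRing σ hw (coordinate p a i) = w i := MvPolynomial.eval₂_X _ _ _

@[simp]
theorem evalCoordinateRing_algebraMap (c : F) :
    evalCoordinateRing σ hw (algebraMap F _ c) = σ c := MvPolynomial.eval₂_C _ _ _

theorem evalCoordinateRing_smul {w' : Fin n → L} (hw' : ∑ i, σ (a i) * w' i ^ p = 0) {r : L}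
    (h : ∀ i, w' i = r * w i) {k : ℕ} {c : CoordinateRing p a}
    (hc : c ∈ coordinateGrading p a k) :
    evalCoordinateRing σ hw' c = r ^ k * evalCoordinateRing σ hw c := by
  obtain ⟨q, hq, rfl⟩ := hc
  obtain rfl : w' = fun i => r * w i := funext h
  exact MvPolynomial.IsHomogeneous.eval₂_mul hq σ r w

end Ring

variable {L : Type u} [Field L] (σ : F →+* L)

/-- The standard affine chart `xᵢ ≠ 0` of the hypersurface. -/
noncomputable def hypersurfaceChart (p : ℕ) {F : Type u} [Field F] {n : ℕ} (a : Fin n → F)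
    (i : Fin n) : Spec (.of (Away (coordinateGrading p a) (coordinate p a i))) ⟶ Hypersurface p a :=
  Proj.awayι (coordinateGrading p a) (coordinate p a i) (coordinate_mem i) one_pos

instance (i : Fin n) : IsOpenImmersion (hypersurfaceChart p a i) :=
  inferInstanceAs (IsOpenImmersion (Proj.awayι _ _ _ _))

/-- The point of the hypersurface with values in a field `L` and with homogeneous coordinates
`w`. -/
noncomputable def hypersurfacePoint {w : Fin n → L} (hw : ∑ i, σ (a i) * w i ^ p = 0) {i : Fin n}
    (hi : w i ≠ 0) : Spec (.of L) ⟶ Hypersurface p a :=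
  projPoint (coordinateGrading p a) (φ := evalCoordinateRing σ hw) (t := coordinate p a i)
    (by rw [evalCoordinateRing_coordinate]; exact hi.isUnit) (coordinate_mem i) one_pos

variable {σ} {w : Fin n → L} (hw : ∑ i, σ (a i) * w i ^ p = 0)

theorem hypersurfacePoint_over {i : Fin n} (hi : w i ≠ 0) :
    hypersurfacePoint σ hw hi ≫ Hypersurface p a ↘ Spec (.of F) =
      Spec.map (CommRingCat.ofHom σ) := by
  change projPoint _ _ _ _ ≫ (Proj.toSpecZero (coordinateGrading p a) ≫ _) = _
  rw [← Category.assoc, projPoint_toSpecZero, ← Spec.map_comp, ← CommRingCat.ofHom_comp]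
  congr 2
  ext c
  exact evalCoordinateRing_algebraMap hw c

/-- Points with proportional homogeneous coordinates are equal. -/
theorem hypersurfacePoint_eq_of_smul {w' : Fin n → L} (hw' : ∑ i, σ (a i) * w' i ^ p = 0)
    {r : L} (h : ∀ i, w' i = r * w i) {i j : Fin n} (hi : w i ≠ 0) (hj : w' j ≠ 0) :
    hypersurfacePoint σ hw hi = hypersurfacePoint σ hw' hj := by
  have hr : r ≠ 0 := by
    rintro rfl
    exact hj (by rw [h, zero_mul])
  have hj' : w j ≠ 0 := fun h0 => hj (by rw [h, h0, mul_zero])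
  have h1 : hypersurfacePoint σ hw hi = hypersurfacePoint σ hw hj' := projPoint_eq _ _ _ _ _ _ _
  rw [h1, hypersurfacePoint, hypersurfacePoint, projPoint, projPoint]
  congr 3
  ext x
  obtain ⟨k, c, hc, rfl⟩ := Away.mk_surjective _ (coordinate_mem j) x
  refine ((hj.isUnit).pow k).mul_right_cancel ?_
  have e1 := evalAway_mk_mul (coordinateGrading p a) (φ := evalCoordinateRing σ hw)
    (t := coordinate p a j) (by rw [evalCoordinateRing_coordinate]; exact hj'.isUnit)
    (coordinate_mem j) k c hc
  have e2 := evalAway_mk_mul (coordinateGrading p a) (φ := evalCoordinateRing σ hw')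
    (t := coordinate p a j) (by rw [evalCoordinateRing_coordinate]; exact hj.isUnit)
    (coordinate_mem j) k c hc
  simp only [evalCoordinateRing_coordinate] at e1 e2
  rw [e2, h, mul_pow, mul_left_comm, e1, evalCoordinateRing_smul hw hw' h hc, smul_eq_mul, mul_one]

end HypersurfacePoint

section PointsFromMorphisms

open HomogeneousLocalization

variable {p : ℕ} {F : Type u} [Field F] {n : ℕ} {a : Fin n → F}

theorem iSup_basicOpen_coordinate :
    ⨆ i, Proj.basicOpen (coordinateGrading p a) (coordinate p a i) = ⊤ := by
  refine Proj.iSup_basicOpen_eq_top' _ _ (fun i => ⟨1, coordinate_mem i⟩) ?_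
  refine eq_top_iff.2 fun c _ => ?_
  obtain ⟨q, rfl⟩ := Ideal.Quotient.mk_surjective c
  induction q using MvPolynomial.induction_on with
  | C c =>
    exact Subalgebra.algebraMap_mem
      (Algebra.adjoin (coordinateGrading p a 0) (Set.range (coordinate p a)))
      (algebraMap F (coordinateGrading p a 0) c)
  | add q q' h h' => rw [map_add]; exact add_mem (h trivial) (h' trivial)
  | mul_X q i h =>
    rw [map_mul]
    exact mul_mem (h trivial) (Algebra.subset_adjoin ⟨i, rfl⟩)

/-- The structure map from the base field to the degree zero part of a localization of the
homogeneous coordinate ring. -/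
noncomputable def baseToAway (c : CoordinateRing p a) :
    F →+* Away (coordinateGrading p a) c :=
  (fromZeroRingHom (coordinateGrading p a) _).comp (algebraMap F (coordinateGrading p a 0))

theorem exists_mem_range_hypersurfaceChart (x : Hypersurface p a) :
    ∃ i, x ∈ Set.range (hypersurfaceChart p a i) := by
  obtain ⟨i, hi⟩ := TopologicalSpace.Opens.mem_iSup.1
    ((iSup_basicOpen_coordinate (p := p) (a := a)).ge (Set.mem_univ x))
  have h : x ∈ (Proj.awayι _ _ (coordinate_mem (p := p) (a := a) i) one_pos).opensRange := by
    rw [Proj.opensRange_awayι]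
    exact hi
  exact ⟨i, h⟩

theorem hypersurfaceChart_over (i : Fin n) :
    hypersurfaceChart p a i ≫ Hypersurface p a ↘ Spec (.of F) =
      Spec.map (CommRingCat.ofHom (baseToAway _)) := by
  change Proj.awayι _ _ _ _ ≫ (Proj.toSpecZero (coordinateGrading p a) ≫ _) = _
  rw [← Category.assoc, Proj.awayι_toSpecZero, ← Spec.map_comp, ← CommRingCat.ofHom_comp]
  rfl

/-- The function `xⱼ / xᵢ` on the standard chart. -/
noncomputable def coordinateDiv (i j : Fin n) :
    Away (coordinateGrading p a) (coordinate p a i) :=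
  Away.mk _ (coordinate_mem i) 1 (coordinate p a j) (by simp [coordinate_mem j])

theorem mul_val_coordinateDiv (i j : Fin n) :
    algebraMap (CoordinateRing p a) (Localization.Away (coordinate p a i)) (coordinate p a i) *
      (coordinateDiv (p := p) (a := a) i j).val =
      algebraMap (CoordinateRing p a) _ (coordinate p a j) := by
  rw [coordinateDiv, Away.val_mk, Localization.mk_eq_mk', mul_comm]
  simp

/-- Dehomogenization of polynomials: `q ∈ F[x]` is sent to `q(x₀ / xᵢ, ..., xₙ₋₁ / xᵢ)`. -/
noncomputable def dehomogenize (i : Fin n) :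
    MvPolynomial (Fin n) F →+* Away (coordinateGrading p a) (coordinate p a i) :=
  MvPolynomial.eval₂Hom (baseToAway _) (coordinateDiv i)

/-- `xᵢᵏ q(x₀ / xᵢ, ..., xₙ₋₁ / xᵢ) = q` for `q` homogeneous of degree `k`. -/
theorem pow_mul_val_dehomogenize (i : Fin n) {k : ℕ} {q : MvPolynomial (Fin n) F}
    (hq : q.IsHomogeneous k) :
    algebraMap (CoordinateRing p a) (Localization.Away (coordinate p a i)) (coordinate p a i) ^ k *
      (dehomogenize (p := p) (a := a) i q).val = algebraMap (CoordinateRing p a) _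
        (Ideal.Quotient.mk _ q) := by
  let S := Localization.Away (coordinate p a i)
  let f : F →+* S := (algebraMap (CoordinateRing p a) S).comp (algebraMap F _)
  have h1 : (dehomogenize (p := p) (a := a) i q).val =
      MvPolynomial.eval₂ f (fun j => (coordinateDiv (p := p) (a := a) i j).val) q := by
    have := MvPolynomial.hom_eval₂ q (baseToAway (coordinate p a i))
      (algebraMap (Away (coordinateGrading p a) (coordinate p a i)) S) (coordinateDiv i)
    exact this
  have h2 : algebraMap (CoordinateRing p a) S (Ideal.Quotient.mk _ q) =
      MvPolynomial.eval₂ f (fun j => algebraMap (CoordinateRing p a) S (coordinate p a j)) q := by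
    have e : (algebraMap (CoordinateRing p a) S).comp (Ideal.Quotient.mk _) =
        MvPolynomial.eval₂Hom f fun j => algebraMap (CoordinateRing p a) S (coordinate p a j) := by
      refine MvPolynomial.ringHom_ext (fun c => ?_) fun j => ?_
      · rw [MvPolynomial.coe_eval₂Hom, MvPolynomial.eval₂_C]; rfl
      · rw [MvPolynomial.coe_eval₂Hom, MvPolynomial.eval₂_X]; rfl
    exact RingHom.congr_fun e q
  rw [h1, h2, ← hq.eval₂_mul]
  congr 1
  funext j
  exact mul_val_coordinateDiv i j

theorem mk_mem_coordinateGrading {q : MvPolynomial (Fin n) F} {k : ℕ} (hq : q.IsHomogeneous k) :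
    Ideal.Quotient.mk _ q ∈ coordinateGrading p a k :=
  ⟨q, hq, rfl⟩

theorem ringHom_diagonalPolynomial {S : Type*} [CommRing S] (g : MvPolynomial (Fin n) F →+* S) :
    g (diagonalPolynomial p a) =
      ∑ i, g (MvPolynomial.C (a i)) * g (MvPolynomial.X i) ^ p := by
  simp [diagonalPolynomial]

theorem away_mk_eq_dehomogenize (i : Fin n) (k : ℕ) {q : MvPolynomial (Fin n) F}
    (hq : q.IsHomogeneous k) (hq' : Ideal.Quotient.mk _ q ∈ coordinateGrading p a (k • 1)) :
    Away.mk (coordinateGrading p a) (coordinate_mem i) k (Ideal.Quotient.mk _ q) hq' =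
      dehomogenize i q := by
  refine HomogeneousLocalization.val_injective _ ?_
  have hu : IsUnit (algebraMap (CoordinateRing p a) (Localization.Away (coordinate p a i))
      (coordinate p a i) ^ k) := (IsLocalization.Away.algebraMap_isUnit _).pow k
  refine hu.mul_left_cancel ?_
  rw [pow_mul_val_dehomogenize i hq, Away.val_mk, Localization.mk_eq_mk', mul_comm, ← map_pow]
  exact IsLocalization.mk'_spec _ _
    (⟨coordinate p a i ^ k, k, rfl⟩ : Submonoid.powers (coordinate p a i))

theorem sum_coordinateDiv_pow (i : Fin n) :
    ∑ j, baseToAway _ (a j) * coordinateDiv (p := p) (a := a) i j ^ p = 0 := by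
  have h1 := away_mk_eq_dehomogenize (p := p) (a := a) i p (diagonalPolynomial_isHomogeneous p a)
    (by rw [smul_eq_mul, mul_one]; exact mk_mem_coordinateGrading
          (diagonalPolynomial_isHomogeneous p a))
  have h2 : dehomogenize (p := p) (a := a) i (diagonalPolynomial p a) =
      ∑ j, baseToAway _ (a j) * coordinateDiv (p := p) (a := a) i j ^ p := by
    rw [ringHom_diagonalPolynomial]
    simp only [dehomogenize, MvPolynomial.coe_eval₂Hom, MvPolynomial.eval₂_C, MvPolynomial.eval₂_X]
  rw [← h2, ← h1]
  refine HomogeneousLocalization.val_injective _ ?_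
  rw [Away.val_mk, HomogeneousLocalization.val_zero, Ideal.Quotient.eq_zero_iff_mem.2
    (Ideal.mem_span_singleton_self _), Localization.mk_zero]

variable {L : Type u} [Field L] {σ : F →+* L}

/-- Every point of the hypersurface over `F`, with values in a field, is given by homogeneous
coordinates. -/
theorem exists_hypersurfacePoint_eq (f : Spec (.of L) ⟶ Hypersurface p a)
    (hf : f ≫ Hypersurface p a ↘ Spec (.of F) = Spec.map (CommRingCat.ofHom σ)) :
    ∃ (w : Fin n → L) (hw : ∑ i, σ (a i) * w i ^ p = 0) (i : Fin n) (hi : w i ≠ 0),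
      f = hypersurfacePoint σ hw hi := by
  obtain ⟨i, hi⟩ := exists_mem_range_hypersurfaceChart (f (IsLocalRing.closedPoint L))
  let ι := hypersurfaceChart p a i
  have hrange : Set.range f ⊆ Set.range ι := by
    rintro _ ⟨y, rfl⟩
    rwa [show y = IsLocalRing.closedPoint L from Subsingleton.elim (α := PrimeSpectrum L) _ _]
  obtain ⟨χ, hχ⟩ := Spec.map_surjective (IsOpenImmersion.lift ι f hrange)
  have hfac : Spec.map χ ≫ ι = f := by rw [hχ]; exact IsOpenImmersion.lift_fac ι f hrange
  have hσ : χ.hom.comp (baseToAway _) = σ := by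
    rw [← hfac, Category.assoc, hypersurfaceChart_over, ← Spec.map_comp] at hf
    have := Spec.map_injective hf
    exact congrArg CommRingCat.Hom.hom this
  let w : Fin n → L := fun j => χ.hom (coordinateDiv i j)
  have hw : ∑ j, σ (a j) * w j ^ p = 0 := by
    have := congrArg χ.hom (sum_coordinateDiv_pow (p := p) (a := a) i)
    rw [map_sum, map_zero] at this
    rw [← this, ← hσ]
    refine Finset.sum_congr rfl fun j _ => ?_
    rw [map_mul, map_pow]; rfl
  have hwi : w i = 1 := by
    have : coordinateDiv (p := p) (a := a) i i = 1 := by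
      refine HomogeneousLocalization.val_injective _ ?_
      refine (IsLocalization.Away.algebraMap_isUnit (coordinate p a i)).mul_left_cancel ?_
      rw [mul_val_coordinateDiv, HomogeneousLocalization.val_one, mul_one]
    simp only [w, this, map_one]
  have hwi0 : w i ≠ 0 := by rw [hwi]; exact one_ne_zero
  refine ⟨w, hw, i, hwi0, ?_⟩
  rw [← hfac, hypersurfacePoint, projPoint]
  congr 2
  ext x
  obtain ⟨k, c, hc, rfl⟩ := Away.mk_surjective _ (coordinate_mem i) x
  have e := evalAway_mk_mul (coordinateGrading p a) (φ := evalCoordinateRing σ hw)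
    (t := coordinate p a i) (by rw [evalCoordinateRing_coordinate]; exact hwi0.isUnit)
    (coordinate_mem i) k c hc
  simp only [evalCoordinateRing_coordinate, hwi, one_pow, mul_one] at e
  refine Eq.trans ?_ e.symm
  obtain ⟨q, hq, rfl⟩ := hc
  have hq : q.IsHomogeneous k := by simpa using hq
  refine (congrArg χ.hom (away_mk_eq_dehomogenize i k hq _)).trans ?_
  rw [dehomogenize, MvPolynomial.coe_eval₂Hom, MvPolynomial.hom_eval₂, hσ]
  rfl

end PointsFromMorphisms

/-! ### The structure morphism and the generic point of a hypersurface -/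

section FiniteType

variable (p : ℕ) {F : Type u} [Field F] {n : ℕ} (a : Fin n → F)

theorem algebraMap_gradeZero_surjective :
    Function.Surjective (algebraMap F (coordinateGrading p a 0)) := by
  rintro ⟨_, q, hq, rfl⟩
  have hq : q.IsHomogeneous 0 := hq
  refine ⟨q.coeff 0, Subtype.ext ?_⟩
  have h : q = MvPolynomial.C (q.coeff 0) :=
    MvPolynomial.totalDegree_eq_zero_iff_eq_C.1 (hq.totalDegree_le.antisymm (Nat.zero_le _))
  exact congrArg (Ideal.Quotient.mk (Ideal.span {diagonalPolynomial p a})) h.symm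

instance : LocallyOfFiniteType (Hypersurface p a ↘ Spec (.of F)) := by
  have h1 : Algebra.FiniteType F (CoordinateRing p a) := inferInstance
  have h2 : IsScalarTower F (coordinateGrading p a 0) (CoordinateRing p a) :=
    IsScalarTower.of_algebraMap_eq' (R := F) (S := coordinateGrading p a 0)
      (A := CoordinateRing p a) rfl
  have h3 : Algebra.FiniteType (coordinateGrading p a 0) (CoordinateRing p a) :=
    Algebra.FiniteType.of_restrictScalars_finiteType F _ _
  have h4 : LocallyOfFiniteType (Spec.map (CommRingCat.ofHom
      (algebraMap F (coordinateGrading p a 0)))) := by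
    rw [HasRingHomProperty.Spec_iff (P := @LocallyOfFiniteType)]
    exact RingHom.FiniteType.of_surjective _ (algebraMap_gradeZero_surjective p a)
  change LocallyOfFiniteType (Proj.toSpecZero (coordinateGrading p a) ≫ _)
  infer_instance

end FiniteType

section GenericPoint

open HomogeneousLocalization

theorem evalAway_injective {σ : Type*} {A L : Type u} [CommRing A] [CommRing L] [SetLike σ A]
    [AddSubgroupClass σ A] (𝒜 : ℕ → σ) [GradedRing 𝒜] {φ : A →+* L}
    (hφ : Function.Injective φ) {t : A} (ht : IsUnit (φ t)) {m : ℕ} (hm : t ∈ 𝒜 m) :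
    Function.Injective (evalAway 𝒜 φ ht) := by
  refine (injective_iff_map_eq_zero _).2 fun x hx => ?_
  obtain ⟨k, c, hc, rfl⟩ := Away.mk_surjective 𝒜 hm x
  have h := evalAway_mk_mul 𝒜 ht hm k c hc
  rw [hx, zero_mul] at h
  obtain rfl : c = 0 := (injective_iff_map_eq_zero φ).1 hφ c h.symm
  refine HomogeneousLocalization.val_injective _ ?_
  rw [Away.val_mk, HomogeneousLocalization.val_zero, Localization.mk_zero]

variable (p : ℕ) [Fact p.Prime] {F : Type u} [Field F] [CharP F p] {d : ℕ}
  {a : Fin (d + 2) → F} (ha : IsAnisotropic p a)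

include ha in
theorem coordinate_ne_zero (i : Fin (d + 2)) : coordinate p a i ≠ 0 := by
  intro h
  obtain ⟨q, hq⟩ := Ideal.mem_span_singleton'.1 (Ideal.Quotient.eq_zero_iff_mem.1 h)
  have h0 := (irreducible_diagonalPolynomial p ha).ne_zero
  have hX : (MvPolynomial.X i : MvPolynomial (Fin (d + 2)) F) ≠ 0 := MvPolynomial.X_ne_zero i
  have hq0 : q ≠ 0 := fun hq0 => hX (by rw [← hq, hq0, zero_mul])
  have h1 := congrArg MvPolynomial.totalDegree hq
  rw [MvPolynomial.totalDegree_mul_of_isDomain hq0 h0, MvPolynomial.totalDegree_X,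
    (diagonalPolynomial_isHomogeneous p a).totalDegree h0] at h1
  have := (Fact.out : p.Prime).two_le
  omega

/-- The homogeneous coordinates of the generic point of the hypersurface. -/
noncomputable def genericCoordinate (p : ℕ) {F : Type u} [Field F] {n : ℕ} (a : Fin n → F)
    (K : Type u) [Field K] [Algebra (CoordinateRing p a) K] (i : Fin n) : K :=
  algebraMap (CoordinateRing p a) K (coordinate p a i)

variable (K : Type u) [Field K] [Algebra (CoordinateRing p a) K] [Algebra F K]
  [IsScalarTower F (CoordinateRing p a) K]

omit [Fact p.Prime] [CharP F p] in
theorem sum_genericCoordinate_pow :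
    ∑ i, algebraMap F K (a i) * genericCoordinate p a K i ^ p = 0 := by
  have h := congrArg (algebraMap (CoordinateRing p a) K) (sum_coordinate_pow p a)
  rw [map_sum, map_zero] at h
  rw [← h]
  refine Finset.sum_congr rfl fun i _ => ?_
  rw [map_mul, map_pow, ← IsScalarTower.algebraMap_apply]
  rfl

omit [Fact p.Prime] [CharP F p] in
theorem evalCoordinateRing_genericCoordinate :
    evalCoordinateRing (algebraMap F K) (sum_genericCoordinate_pow (a := a) p K) =
      algebraMap (CoordinateRing p a) K := by
  refine Ideal.Quotient.ringHom_ext (MvPolynomial.ringHom_ext (fun c => ?_) fun i => ?_)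
  · exact (evalCoordinateRing_algebraMap (sum_genericCoordinate_pow (a := a) p K) c).trans
      (IsScalarTower.algebraMap_apply F (CoordinateRing p a) K c)
  · exact evalCoordinateRing_coordinate (sum_genericCoordinate_pow (a := a) p K) i

variable [IsFractionRing (CoordinateRing p a) K]

omit [Algebra F K] [IsScalarTower F (CoordinateRing p a) K] in
include ha in
theorem genericCoordinate_ne_zero (i : Fin (d + 2)) : genericCoordinate p a K i ≠ 0 := by
  have := isDomain_coordinateRing p ha
  exact (map_ne_zero_iff _ (IsFractionRing.injective (CoordinateRing p a) K)).2
    (coordinate_ne_zero p ha i)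

theorem isDominant_Spec_map_of_injective {A B : Type u} [CommRing A] [CommRing B] {φ : A →+* B}
    (hφ : Function.Injective φ) : IsDominant (Spec.map (CommRingCat.ofHom φ)) :=
  ⟨(PrimeSpectrum.denseRange_comap_iff_ker_le_nilRadical φ).2
    (by rw [(RingHom.injective_iff_ker_eq_bot φ).1 hφ]; exact bot_le)⟩

/-- The generic point of the hypersurface, as a point with values in the fraction field of the
homogeneous coordinate ring. -/
noncomputable def genericHypersurfacePoint : Spec (.of K) ⟶ Hypersurface p a :=
  hypersurfacePoint (algebraMap F K) (sum_genericCoordinate_pow (a := a) p K)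
    (genericCoordinate_ne_zero p ha K 0)

/-- The generic point lies in every standard chart and is dense there. -/
theorem exists_isDominant_comp_hypersurfaceChart (i : Fin (d + 2)) :
    ∃ q : Spec (.of K) ⟶ Spec (.of (Away (coordinateGrading p a) (coordinate p a i))),
      IsDominant q ∧ genericHypersurfacePoint p ha K = q ≫ hypersurfaceChart p a i := by
  have := isDomain_coordinateRing p ha
  refine ⟨_, isDominant_Spec_map_of_injective
    (evalAway_injective (coordinateGrading p a) (φ := evalCoordinateRing (algebraMap F K)
      (sum_genericCoordinate_pow (a := a) p K)) ?_ ?_ (coordinate_mem i)), ?_⟩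
  · rw [evalCoordinateRing_genericCoordinate]
    exact IsFractionRing.injective (CoordinateRing p a) K
  · rw [evalCoordinateRing_coordinate]
    exact (genericCoordinate_ne_zero p ha K i).isUnit
  · exact projPoint_eq _ _ _ _ _ _ _

theorem denseRange_genericHypersurfacePoint : DenseRange (genericHypersurfacePoint p ha K) := by
  intro x
  obtain ⟨i, y, rfl⟩ := exists_mem_range_hypersurfaceChart x
  obtain ⟨q, hq, h⟩ := exists_isDominant_comp_hypersurfaceChart p ha K i
  rw [h, Scheme.Hom.comp_base, TopCat.coe_comp, Set.range_comp]
  exact image_closure_subset_closure_image (hypersurfaceChart p a i).continuous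
    ⟨y, hq.1 y, rfl⟩

include ha in
theorem isIntegral_hypersurface : IsIntegral (Hypersurface p a) := by
  have hd := isDomain_coordinateRing p ha
  let K := FractionRing (CoordinateRing p a)
  let g := genericHypersurfacePoint p ha K
  have hg : DenseRange g := denseRange_genericHypersurfacePoint p ha K
  have h1 : IrreducibleSpace (Hypersurface p a) := by
    have h : IsIrreducible (Set.range g) := by
      rw [← Set.image_univ]
      exact (IrreducibleSpace.isIrreducible_univ (Spec (.of K))).image _ g.continuous.continuousOn
    have := h.closure
    rw [hg.closure_range] at this
    have h' : PreirreducibleSpace (Hypersurface p a) := ⟨this.2⟩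
    exact ⟨⟨g (IsLocalRing.closedPoint K)⟩⟩
  have h2 : ∀ x : Hypersurface p a, IsReduced ((Hypersurface p a).presheaf.stalk x) := by
    intro x
    obtain ⟨i, y, rfl⟩ := exists_mem_range_hypersurfaceChart x
    have hr : IsReduced (Away (coordinateGrading p a) (coordinate p a i)) :=
      isReduced_of_injective (evalAway (coordinateGrading p a) (φ := algebraMap _ K)
        (t := coordinate p a i) (genericCoordinate_ne_zero p ha K i).isUnit)
        (evalAway_injective _ (IsFractionRing.injective (CoordinateRing p a) K) _
          (coordinate_mem i))
    have : _root_.IsReduced (CommRingCat.of (Away (coordinateGrading p a) (coordinate p a i))) := hr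
    exact isReduced_of_injective _
      (asIso ((hypersurfaceChart p a i).stalkMap y)).commRingCatIsoToRingEquiv.injective
  have h3 := isReduced_of_isReduced_stalk (Hypersurface p a)
  exact isIntegral_of_irreducibleSpace_of_isReduced _

theorem genericHypersurfacePoint_closedPoint [IsIntegral (Hypersurface p a)] :
    genericHypersurfacePoint p ha K (IsLocalRing.closedPoint K) =
      genericPoint (Hypersurface p a) := by
  refine (genericPoint_spec _).eq (?_ : IsGenericPoint _ _) |>.symm
  rw [isGenericPoint_def, ← (denseRange_genericHypersurfacePoint p ha K).closure_range]
  congr 1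
  refine Set.Subset.antisymm (Set.singleton_subset_iff.2 ⟨_, rfl⟩) ?_
  rintro _ ⟨y, rfl⟩
  rw [show y = IsLocalRing.closedPoint K from Subsingleton.elim (α := PrimeSpectrum K) _ _]
  rfl

end GenericPoint

section FunctionField

/-- On an `F`-scheme, the canonical morphism from the spectrum of the function field is over `F`. -/
theorem fromSpecStalk_genericPoint_over (F : Type u) [Field F] (X : Scheme.{u}) [IsIntegral X]
    [X.Over (Spec (.of F))] :
    X.fromSpecStalk (genericPoint X) ≫ X ↘ Spec (.of F) =
      Spec.map (CommRingCat.ofHom (baseToFunctionField F X)) := by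
  rw [← cancel_mono (Spec (.of F)).toSpecΓ, Category.assoc, Scheme.toSpecΓ_naturality,
    Scheme.fromSpecStalk_toSpecΓ_assoc, ← SpecMap_ΓSpecIso_hom, ← Spec.map_comp, ← Spec.map_comp]
  congr 1
  ext x
  simp [baseToFunctionField]

/-- A field-valued point of `X` whose image is `y` factors through the local ring of `X` at `y`. -/
theorem exists_SpecMap_fromSpecStalk_eq {X : Scheme.{u}} {L : Type u} [Field L]
    (q : Spec (.of L) ⟶ X) {y : X} (hy : q (IsLocalRing.closedPoint L) = y) :
    ∃ τ : X.presheaf.stalk y ⟶ .of L, Spec.map τ ≫ X.fromSpecStalk y = q := by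
  subst hy
  exact ⟨_, Scheme.Spec_stalkClosedPointTo_fromSpecStalk q⟩

end FunctionField

/-! ### The closure of the image of a rational map -/

section ImageScheme

variable {X Y : Scheme.{u}}

instance (Z : TopologicalSpace.Closeds Y) :
    IsReduced (Scheme.IdealSheafData.vanishingIdeal Z).subscheme := by
  let I := Scheme.IdealSheafData.vanishingIdeal Z
  have (U : Y.affineOpens) : IsReduced (I.subschemeCover.openCover.X U) := by
    have : _root_.IsReduced (Γ(Y, U.1) ⧸ I.ideal U) := by
      rw [← Ideal.isRadical_iff_quotient_reduced, Scheme.IdealSheafData.vanishingIdeal_ideal]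
      exact PrimeSpectrum.isRadical_vanishingIdeal _
    exact inferInstanceAs (IsReduced (Spec (.of (Γ(Y, U.1) ⧸ I.ideal U))))
  exact @IsReduced.of_openCover I.subscheme I.subschemeCover.openCover this

instance (f : X ⤏ Y) : IsReduced (imageScheme f) :=
  inferInstanceAs (IsReduced (Scheme.IdealSheafData.vanishingIdeal _).subscheme)

instance (f : X ⤏ Y) : IsClosedImmersion (imageSchemeι f) :=
  inferInstanceAs (IsClosedImmersion (Scheme.IdealSheafData.subschemeι _))

theorem range_hom_subset_closure_of_equiv {f g : X.PartialMap Y} (h : f.equiv g) :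
    Set.range f.hom ⊆ closure (Set.range g.hom) := by
  obtain ⟨W, hW, hWl, hWr, e⟩ := h
  have h1 := (Opens.isDominant_homOfLE hW hWl).1
  have h2 := h1.closure_range
  rintro _ ⟨x, rfl⟩
  have h3 : f.hom x ∈ f.hom '' closure (Set.range (X.homOfLE hWl)) := by
    rw [h2]
    exact ⟨x, trivial, rfl⟩
  refine closure_mono ?_ (image_closure_subset_closure_image f.hom.continuous h3)
  rw [← Set.range_comp]
  rintro _ ⟨y, rfl⟩
  exact ⟨X.homOfLE hWr y, (congrArg (fun q : W.toScheme ⟶ Y => q y) e).symm⟩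

/-- The closure of the image of a rational map can be computed from any representative. -/
theorem closureOfImage_toRationalMap (f : X.PartialMap Y) :
    closureOfImage f.toRationalMap = .closure (Set.range f.hom) := by
  refine le_antisymm ?_ ?_
  · refine TopologicalSpace.Closeds.closure_le.2 (Set.iUnion₂_subset fun g hg => ?_)
    exact range_hom_subset_closure_of_equiv (Scheme.PartialMap.toRationalMap_eq_iff.1 hg)
  · refine TopologicalSpace.Closeds.closure_le.2 fun y hy => subset_closure ?_
    exact Set.mem_iUnion₂.2 ⟨f, rfl, hy⟩

/-- Every representative of a rational map from a reduced scheme factors through a dominant morphism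
to the closure of the image. -/
theorem exists_lift_imageScheme [IsReduced X] (f : X.PartialMap Y) :
    ∃ q : f.domain.toScheme ⟶ imageScheme f.toRationalMap,
      IsDominant q ∧ q ≫ imageSchemeι f.toRationalMap = f.hom := by
  have hker : (imageSchemeι f.toRationalMap).ker = f.hom.ker := by
    refine (Scheme.IdealSheafData.ker_subschemeι _).trans ?_
    rw [← Scheme.IdealSheafData.map_bot, ← Scheme.nilradical_eq_bot,
      ← Scheme.IdealSheafData.vanishingIdeal_top, Scheme.IdealSheafData.map_vanishingIdeal,
      closureOfImage_toRationalMap]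
    congr 2
    exact Set.image_univ.symm
  have hfac := IsClosedImmersion.lift_fac (imageSchemeι f.toRationalMap) f.hom hker.le
  refine ⟨_, ⟨?_⟩, hfac⟩
  set q := IsClosedImmersion.lift (imageSchemeι f.toRationalMap) f.hom hker.le
  have h1 : Set.range (imageSchemeι f.toRationalMap) = closure (Set.range f.hom) := by
    refine (Scheme.IdealSheafData.range_subschemeι _).trans ?_
    rw [Scheme.IdealSheafData.coe_support_vanishingIdeal, closureOfImage_toRationalMap]
    rfl
  rw [DenseRange, (imageSchemeι f.toRationalMap).isClosedEmbedding.isEmbedding.isInducing.dense_iff]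
  intro x
  have h2 : imageSchemeι f.toRationalMap x ∈ closure (Set.range f.hom) := by
    rw [← h1]
    exact ⟨x, rfl⟩
  rwa [← hfac, Scheme.Hom.comp_base, TopCat.coe_comp, Set.range_comp] at h2

theorem isIntegral_of_isDominant {U Z : Scheme.{u}} [IsIntegral U] [IsReduced Z] (q : U ⟶ Z)
    [hq : IsDominant q] : IsIntegral Z := by
  have h1 : IrreducibleSpace Z := by
    have h : IsIrreducible (Set.range q) := by
      rw [← Set.image_univ]
      exact (IrreducibleSpace.isIrreducible_univ U).image _ q.continuous.continuousOn
    have := h.closure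
    rw [hq.1.closure_range] at this
    have h' : PreirreducibleSpace Z := ⟨this.2⟩
    exact ⟨⟨q (genericPoint U)⟩⟩
  exact isIntegral_of_irreducibleSpace_of_isReduced _

theorem isIntegral_imageScheme [IsIntegral X] (f : X ⤏ Y) : IsIntegral (imageScheme f) := by
  obtain ⟨f, rfl⟩ := f.exists_rep
  obtain ⟨q, hq, -⟩ := exists_lift_imageScheme f
  have : Nonempty f.domain := f.dense_domain.nonempty.to_subtype
  exact isIntegral_of_isDominant q

theorem apply_genericPoint_of_isDominant {U Z : Scheme.{u}} [IrreducibleSpace U]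
    [IrreducibleSpace Z] (q : U ⟶ Z) [hq : IsDominant q] :
    q (genericPoint U) = genericPoint Z := by
  refine ((genericPoint_spec Z).eq (?_ : IsGenericPoint _ _)).symm
  have h := (genericPoint_spec U).image q.continuous
  rwa [Set.image_univ, hq.1.closure_range] at h

end ImageScheme

/-! ### Dominant rational maps with a left inverse -/

section Birational

theorem isOver_partialMap_comp {S X Y Z : Scheme.{u}} [PreirreducibleSpace X] [Nonempty Y]
    [X.Over S] [Y.Over S] [Z.Over S] (f : X.PartialMap Y) [IsDominant f.hom] [hf : f.IsOver S]
    (g : Y.PartialMap Z) [hg : g.IsOver S] : (f.comp g).IsOver S := by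
  have hf : f.hom ≫ Y ↘ S = f.domain.ι ≫ X ↘ S := (Scheme.Hom.isOver_iff _).1 hf
  have hg : g.hom ≫ Z ↘ S = g.domain.ι ≫ Y ↘ S := (Scheme.Hom.isOver_iff _).1 hg
  refine (Scheme.Hom.isOver_iff _).2 ?_
  change ((f.domain.ι.isoImage (f.hom ⁻¹ᵁ g.domain)).inv ≫ f.hom ∣_ g.domain ≫ g.hom) ≫ Z ↘ S =
    (f.domain.ι ''ᵁ f.hom ⁻¹ᵁ g.domain).ι ≫ X ↘ S
  rw [Category.assoc, Category.assoc, hg, ← Category.assoc (f.hom ∣_ g.domain), morphismRestrict_ι,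
    Category.assoc, hf, ← Scheme.Hom.isoImage_inv_ι]
  simp only [Category.assoc]

/-- If a dominant partial map `φ : X ⇢ Z` of integral schemes has a left inverse up to
equivalence, then it restricts to an open immersion on a dense open subscheme. -/
theorem exists_isOpenImmersion_of_comp_eq_id {X Z : Scheme.{u}} [IsIntegral X] [IsIntegral Z]
    (φ : X.PartialMap Z) [IsDominant φ.hom] (g : Z.PartialMap X) [IsAffine g.domain]
    (h : (φ.comp g).toRationalMap = Scheme.RationalMap.id X) :
    ∃ (W : X.Opens) (_ : Dense (W : Set X)) (hW : W ≤ φ.domain),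
      IsOpenImmersion (X.homOfLE hW ≫ φ.hom) := by
  obtain ⟨W, hW, hWl, hWr, e⟩ := Scheme.PartialMap.toRationalMap_eq_iff.1 h
  have hle : W ≤ φ.domain := hWl.trans (by
    rintro _ ⟨x, -, rfl⟩
    exact x.2)
  have hWl' : W ≤ φ.domain.ι ''ᵁ φ.hom ⁻¹ᵁ g.domain := hWl
  let s₀ : W.toScheme ⟶ g.domain :=
    X.homOfLE hWl' ≫ (φ.domain.ι.isoImage (φ.hom ⁻¹ᵁ g.domain)).inv ≫ φ.hom ∣_ g.domain
  have hs₀ : s₀ ≫ g.hom = W.ι := by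
    refine (Category.assoc _ _ _).trans ((congrArg (_ ≫ ·) (Category.assoc _ _ _)).trans ?_)
    exact e.trans ((congrArg (_ ≫ ·) (Category.comp_id _)).trans (X.homOfLE_ι _))
  have hs₀' : s₀ ≫ g.domain.ι = X.homOfLE hle ≫ φ.hom := by
    simp only [s₀, Category.assoc, morphismRestrict_ι]
    simp only [← Category.assoc]
    congr 1
    rw [← cancel_mono φ.domain.ι]
    simp
  have hdom : IsDominant s₀ := by
    have h1 : IsDominant (X.homOfLE hle) := Opens.isDominant_homOfLE hW hle
    have h2 : IsDominant (s₀ ≫ g.domain.ι) := by rw [hs₀']; infer_instance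
    exact IsDominant.of_comp_of_isOpenImmersion s₀ g.domain.ι
  have hrange : Set.range s₀ ⊆ Set.range (g.hom ⁻¹ᵁ W).ι := by
    rintro _ ⟨x, rfl⟩
    have hx : g.hom (s₀ x) ∈ W := by
      rw [← Scheme.Hom.comp_apply, hs₀]
      exact x.2
    simpa using hx
  -- `s` is a section of the separated morphism `g.hom ∣_ W`
  let s := IsOpenImmersion.lift (g.hom ⁻¹ᵁ W).ι s₀ hrange
  have hs : s ≫ (g.hom ⁻¹ᵁ W).ι = s₀ := IsOpenImmersion.lift_fac _ _ _
  have hid : s ≫ g.hom ∣_ W = 𝟙 _ := by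
    rw [← cancel_mono W.ι, Category.assoc, morphismRestrict_ι, ← Category.assoc, hs, hs₀,
      Category.id_comp]
  -- this uses that the source of `g.hom` is affine
  have hsep : IsSeparated g.hom := inferInstance
  have hclosed : IsClosedImmersion s := by
    have : IsClosedImmersion (s ≫ g.hom ∣_ W) := by rw [hid]; infer_instance
    exact IsClosedImmersion.of_comp s (g.hom ∣_ W)
  have hdom' : IsDominant s := by
    have : IsDominant (s ≫ (g.hom ⁻¹ᵁ W).ι) := by rw [hs]; exact hdom
    exact IsDominant.of_comp_of_isOpenImmersion s (g.hom ⁻¹ᵁ W).ι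
  have hsurj : Surjective s := surjective_of_isDominant_of_isClosed_range s
    s.isClosedEmbedding.isClosed_range
  have hiso : IsIso s := isIso_of_isClosedImmersion_of_surjective s
  refine ⟨W, hW, hle, ?_⟩
  rw [← hs₀', ← hs]
  infer_instance

end Birational

/-! ### Rational maps between hypersurfaces -/

section Hypersurface

variable (p : ℕ) [Fact p.Prime] {F : Type u} [Field F] [CharP F p] {d : ℕ}
  {a : Fin (d + 2) → F} (ha : IsAnisotropic p a)

/-- If `𝔦₁(X) = 1`, then `X` has a unique point over `F` with values in its function field. -/
theorem eq_of_firstDefectIndex_eq_one [IsIntegral (Hypersurface p a)]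
    (h1 : firstDefectIndex p a = 1)
    (q q' : Spec (.of (Hypersurface p a).functionField) ⟶ Hypersurface p a)
    (hq : q ≫ Hypersurface p a ↘ Spec (.of F) =
      Spec.map (CommRingCat.ofHom (baseToFunctionField F (Hypersurface p a))))
    (hq' : q' ≫ Hypersurface p a ↘ Spec (.of F) =
      Spec.map (CommRingCat.ofHom (baseToFunctionField F (Hypersurface p a)))) : q = q' := by
  obtain ⟨w, hw, i, hi, rfl⟩ := exists_hypersurfacePoint_eq q hq
  obtain ⟨w', hw', j, hj, rfl⟩ := exists_hypersurfacePoint_eq q' hq'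
  have hc : CharP (Hypersurface p a).functionField p :=
    charP_of_injective_ringHom (baseToFunctionField F (Hypersurface p a)).injective p
  rw [firstDefectIndex, dif_pos ‹_›] at h1
  change Module.finrank _ (isotropicSubspace p fun i =>
    baseToFunctionField F (Hypersurface p a) (a i)) = 1 at h1
  have hw0 : (⟨w, hw⟩ : isotropicSubspace p fun i =>
      baseToFunctionField F (Hypersurface p a) (a i)) ≠ 0 := fun h0 =>
    hi (congrFun (congrArg Subtype.val h0) i)
  obtain ⟨r, hr⟩ := (finrank_eq_one_iff_of_nonzero' _ hw0).1 h1 ⟨w', hw'⟩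
  exact hypersurfacePoint_eq_of_smul hw hw' (r := r)
    (fun k => (congrFun (congrArg Subtype.val hr) k).symm) hi hj

theorem rationalMap_eq_id_of_firstDefectIndex_eq_one [IsIntegral (Hypersurface p a)]
    (h1 : firstDefectIndex p a = 1) (g : Hypersurface p a ⤏ Hypersurface p a)
    (hg : g.IsOver (Spec (.of F))) : g = Scheme.RationalMap.id _ := by
  have key : ∀ g : Hypersurface p a ⤏ Hypersurface p a, g.IsOver (Spec (.of F)) →
      g.fromFunctionField ≫ Hypersurface p a ↘ Spec (.of F) =
        Spec.map (CommRingCat.ofHom (baseToFunctionField F (Hypersurface p a))) := by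
    intro g hg
    have := ((Scheme.RationalMap.equivFunctionFieldOver (S := Spec (.of F))).symm ⟨g, hg⟩).2
    exact ((Scheme.Hom.isOver_iff _).1 this).trans (fromSpecStalk_genericPoint_over F _)
  exact Scheme.RationalMap.eq_of_fromFunctionField_eq _ _
    (eq_of_firstDefectIndex_eq_one p h1 _ _ (key g hg) (key _ inferInstance))

/-- A field-valued generic point lies in every nonempty open subscheme. -/
theorem exists_lift_opens_of_genericPoint {X : Scheme.{u}} [IrreducibleSpace X] (U : X.Opens)
    [Nonempty U] {K : Type u} [Field K] (γ : Spec (.of K) ⟶ X)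
    (hγ : γ (IsLocalRing.closedPoint K) = genericPoint X) :
    ∃ r : Spec (.of K) ⟶ U, r ≫ U.ι = γ ∧
      U.ι (r (IsLocalRing.closedPoint K)) = genericPoint X := by
  have hrange : Set.range γ ⊆ Set.range U.ι := by
    rintro _ ⟨y, rfl⟩
    rw [show y = IsLocalRing.closedPoint K from Subsingleton.elim (α := PrimeSpectrum K) _ _, hγ,
      U.range_ι]
    exact ((genericPoint_spec X).mem_open_set_iff U.isOpen).2 (by simpa using ‹Nonempty U›)
  refine ⟨_, IsOpenImmersion.lift_fac U.ι γ hrange, ?_⟩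
  refine Eq.trans ?_ hγ
  exact congrArg (fun q : Spec (.of K) ⟶ X => q (IsLocalRing.closedPoint K))
    (IsOpenImmersion.lift_fac U.ι γ hrange)

/-- If a morphism over `F` from the spectrum of a field `K` hits the generic point of `Z`, then
`F(Z)` embeds in `K` over `F`. -/
theorem exists_functionField_ringHom {F : Type u} [Field F] {Z : Scheme.{u}} [IsIntegral Z]
    [Z.Over (Spec (.of F))] {K : Type u} [Field K] (r : Spec (.of K) ⟶ Z)
    (hr : r (IsLocalRing.closedPoint K) = genericPoint Z) {σ : F →+* K}
    (h : r ≫ Z ↘ Spec (.of F) = Spec.map (CommRingCat.ofHom σ)) :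
    ∃ τ : Z.functionField →+* K, τ.comp (baseToFunctionField F Z) = σ := by
  obtain ⟨τ, rfl⟩ := exists_SpecMap_fromSpecStalk_eq r hr
  refine ⟨τ.hom, ?_⟩
  have h' : Spec.map (CommRingCat.ofHom (baseToFunctionField F Z) ≫ τ) =
      Spec.map (CommRingCat.ofHom σ) := by
    rw [← h, Category.assoc]
    exact (Spec.map_comp _ _).trans
      (congrArg (Spec.map τ ≫ ·) (fromSpecStalk_genericPoint_over F Z).symm)
  exact congrArg CommRingCat.Hom.hom (Spec.map_injective h')

include ha in
/-- If an integral scheme `Z` that maps to the hypersurface of the form `b` is dominated by an open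
subscheme of the hypersurface of the form `a`, then there is a rational map from `Z` to the latter:
the function field of `Z` makes `b` isotropic, hence `a` as well. -/
theorem exists_rationalMap_of_isDominant {e : ℕ} {b : Fin e → F} (hb : IsAnisotropic p b)
    (U : (Hypersurface p a).Opens) [Nonempty U] {Z : Scheme.{u}} [IsIntegral Z]
    [Z.Over (Spec (.of F))] (q : U.toScheme ⟶ Z) [IsDominant q] (ι : Z ⟶ Hypersurface p b)
    (hι : ι ≫ Hypersurface p b ↘ Spec (.of F) = Z ↘ Spec (.of F))
    (hq : q ≫ Z ↘ Spec (.of F) = U.ι ≫ Hypersurface p a ↘ Spec (.of F)) :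
    ∃ g : Z ⤏ Hypersurface p a, g.IsOver (Spec (.of F)) := by
  have hX := isIntegral_hypersurface p ha
  have hdC := isDomain_coordinateRing p ha
  obtain ⟨v, hv, j, hj, -⟩ := exists_hypersurfacePoint_eq (p := p) (a := b)
    (L := Z.functionField) (Z.fromSpecStalk (genericPoint Z) ≫ ι)
    ((Category.assoc _ _ _).trans ((congrArg (_ ≫ ·) hι).trans
      (fromSpecStalk_genericPoint_over F Z)))
  let L : Type u := Z.functionField
  let K := FractionRing (CoordinateRing p a)
  obtain ⟨r, hr, hr'⟩ := exists_lift_opens_of_genericPoint U (genericHypersurfacePoint p ha K)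
    (genericHypersurfacePoint_closedPoint p ha K)
  have hr' : r (IsLocalRing.closedPoint K) = genericPoint U :=
    U.ι.isOpenEmbedding.injective (hr'.trans (genericPoint_eq_of_isOpenImmersion U.ι).symm)
  obtain ⟨τ, hτ⟩ := exists_functionField_ringHom (F := F) (Z := Z) (r ≫ q) (σ := algebraMap F K)
    ((congrArg q hr').trans (apply_genericPoint_of_isDominant q)) (by
      rw [Category.assoc, hq, ← Category.assoc, hr]
      exact hypersurfacePoint_over _ _)
  let _ : Algebra F L := (baseToFunctionField F Z).toAlgebra
  let _ : Algebra L K := τ.toAlgebra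
  have : IsScalarTower F L K := IsScalarTower.of_algebraMap_eq' hτ.symm
  obtain ⟨w, hw0, hw⟩ := exists_isotropic_of_isotropic p (L := L) (M := K) ha hb
    (v := v) (fun h0 => hj (congrFun h0 j)) hv
  obtain ⟨i, hi⟩ := Function.ne_iff.1 hw0
  have hover := hypersurfacePoint_over (σ := baseToFunctionField F Z) hw hi
  obtain ⟨g, hg⟩ := Scheme.RationalMap.equivFunctionField (Z ↘ Spec (.of F))
    (Hypersurface p a ↘ Spec (.of F)) ⟨hypersurfacePoint (baseToFunctionField F Z) hw hi,
      hover.trans (fromSpecStalk_genericPoint_over F Z).symm⟩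
  exact ⟨g, Scheme.RationalMap.isOver_iff.2 hg⟩

end Hypersurface

theorem proposition5p10 (p : ℕ) [Fact p.Prime] {F : Type u} [Field F] [CharP F p] {d e : ℕ}
    (a : Fin (d + 2) → F) (ha : IsAnisotropic p a)
    (b : Fin (e + 2) → F) (hb : IsAnisotropic p b)
    (f : Hypersurface p a ⤏ Hypersurface p b) (hf : f.IsOver (Spec (.of F))) :
    (∃ g : imageScheme f ⤏ Hypersurface p a, g.IsOver (Spec (.of F))) ∧
      (firstDefectIndex p a = 1 →
        ∃ h : (Hypersurface p a).PartialIso (imageScheme f),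
          h.IsOver (Hypersurface p a ↘ Spec (.of F)) (imageScheme f ↘ Spec (.of F)) ∧
            h.toRationalMap.compHom (imageSchemeι f) = f) := by
  have hX := isIntegral_hypersurface p ha
  obtain ⟨f, hf', rfl⟩ := f.exists_partialMap_over (S := Spec (.of F))
  have hf' := (Scheme.Hom.isOver_iff _).1 hf'
  have hZ := isIntegral_imageScheme f.toRationalMap
  have hU : Nonempty f.domain := f.dense_domain.nonempty.to_subtype
  obtain ⟨q, hq, hqι⟩ := exists_lift_imageScheme f
  have hqF : q ≫ imageScheme f.toRationalMap ↘ Spec (.of F) =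
      f.domain.ι ≫ Hypersurface p a ↘ Spec (.of F) := by
    refine Eq.trans ?_ hf'
    rw [← hqι, Category.assoc]
    rfl
  obtain ⟨g, hg⟩ := exists_rationalMap_of_isDominant p ha hb f.domain q
    (imageSchemeι f.toRationalMap) rfl hqF
  refine ⟨⟨g, hg⟩, fun h1 => ?_⟩
  let φ : (Hypersurface p a).PartialMap (imageScheme f.toRationalMap) :=
    ⟨f.domain, f.dense_domain, q⟩
  have hφ : φ.IsOver (Spec (.of F)) := (Scheme.Hom.isOver_iff _).2 hqF
  have hφd : IsDominant φ.hom := hq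
  obtain ⟨g, hg', rfl⟩ := g.exists_partialMap_over (S := Spec (.of F))
  -- Restricting `g` to an affine open subscheme makes it a separated morphism.
  obtain ⟨z, hz⟩ := g.dense_domain.nonempty
  obtain ⟨_, ⟨B, hB, rfl⟩, hzB, hBg⟩ :=
    (imageScheme f.toRationalMap).isBasis_affineOpens.exists_subset_of_mem_open hz g.domain.2
  have hBg : B ≤ g.domain := hBg
  have hBd : Dense (B : Set (imageScheme f.toRationalMap)) := B.2.dense ⟨z, hzB⟩
  have : IsAffine (g.restrict B hBd hBg).domain := hB
  obtain ⟨W, hW, hWφ, hopen⟩ := exists_isOpenImmersion_of_comp_eq_id φ (g.restrict B hBd hBg)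
    (rationalMap_eq_id_of_firstDefectIndex_eq_one p h1 _
      ⟨_, isOver_partialMap_comp φ (g.restrict B hBd hBg), rfl⟩)
  have hdom : IsDominant ((Hypersurface p a).homOfLE hWφ ≫ φ.hom) := by
    have := Opens.isDominant_homOfLE hW hWφ
    infer_instance
  let s := (Hypersurface p a).homOfLE hWφ ≫ φ.hom
  let h : (Hypersurface p a).PartialIso (imageScheme f.toRationalMap) :=
    { source := W
      dense_source := hW
      target := s.opensRange
      dense_target := hdom.1
      iso := s.isoOpensRange }
  have hs : s ≫ imageSchemeι f.toRationalMap = (Hypersurface p a).homOfLE hWφ ≫ f.hom := by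
    rw [← hqι, ← Category.assoc]
  have hh : h.iso.hom ≫ h.target.ι = s := s.isoOpensRange_hom_ι
  refine ⟨h, ?_, ?_⟩
  · change _ ≫ _ ≫ (imageSchemeι f.toRationalMap ≫ _) = _
    rw [← Category.assoc, hh, ← Category.assoc, hs, Category.assoc, hf']
    exact (Category.assoc _ _ _).symm.trans
      (congrArg (· ≫ _) ((Hypersurface p a).homOfLE_ι hWφ))
  · refine (Scheme.RationalMap.compHom_toRationalMap _ _).symm.trans
      (Eq.trans (congrArg Scheme.PartialMap.toRationalMap ?_) (f.restrict_toRationalMap W hW hWφ))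
    refine Scheme.PartialMap.ext _ _ rfl ?_
    change (h.iso.hom ≫ h.target.ι) ≫ imageSchemeι f.toRationalMap =
      (Scheme.isoOfEq _ rfl).hom ≫ (Hypersurface p a).homOfLE hWφ ≫ f.hom
    rw [hh, hs]
    simp
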